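/- Let $k=\mathbb{R}$ or $\mathbb{C}$, $I=[0,1]$, and let $\mathcal{A}$ be the category of locally convex $k$-algebras (associative $k$-algebras, not necessarily unital, with a complete Hausdorff locally convex topology for which the multiplication is jointly continuous) and continuous $k$-homomorphisms. For $A\in\mathcal{A}$ let $A^{\infty(I)}\in\mathcal{A}$ be the algebra of all smooth maps $I\to A$ with the topology of uniform convergence of the maps and of all their derivatives. For $t\in I$ let $\varepsilon_t:A^{\infty(I)}\to A$, $\varepsilon_t(f)=f(t)$, let $\mathcal{I}(A)=\mathrm{Ker}\,\varepsilon_0$ and let $\tau_A:\mathcal{I}(A)\to A$ be the restriction of $\varepsilon_1$. The iterates $\mathcal{I}^{n+1}(A)$ (in degree $n\ge -1$) form an augmented simplicial algebra $\mathcal{I}^+_*(A)$ with faces $\mathcal{I}^i\tau\,\mathcal{I}^{n-i}:\mathcal{I}^{n+1}(A)\to\mathcal{I}^{n}(A)$, $0\le i\le n$. With $GL(A)=\mathrm{Ker}\,(GL(A^+)\to GL(k))$, where $A^+=A+k$ is $A$ with a unit adjoined and $GL=\varinjlim_m GL_m$, the smooth $K$-functors are $K^{sm}_n(A)=\pi_{n-2}\,GL(\mathcal{I}^+_*(A))$,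 $n\ge 1$; here $\pi_m$ ($m\ge -1$) is the group of elements of degree $m$ all of whose faces are trivial, modulo the images under the zeroth face of the elements of degree $m+1$ all of whose other faces are trivial (so $K_1^{sm}(A)=GL(A)/\mathrm{Im}\,GL(\tau_A)$). Proposition 1.8. For every $n\ge 1$ the functor $K^{sm}_n$ from $\mathcal{A}$ to groups is a smooth homotopy functor: if $f,g:A\to B$ are morphisms of $\mathcal{A}$ for which there is a morphism $h:A\to B^{\infty(I)}$ with $\varepsilon_0h=f$ and $\varepsilon_1h=g$, then $K^{sm}_n(f)=K^{sm}_n(g)$. Moreover, for every $A\in\mathcal{A}$ the inclusion $A\to A^{\infty(I)}$ as the constant maps induces an isomorphism $K^{sm}_n(A)\to K^{sm}_n(A^{\infty(I)})$. -/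

import Mathlib

universe u v w

namespace SmoothK

open CategoryTheory Topology Filter
open scoped unitInterval

set_option linter.unusedSectionVars false

noncomputable section

section Calculus

variable (𝕜 : Type) [RCLike 𝕜] {A : Type u} [NonUnitalRing A] [Module 𝕜 A]

/-- `a` is the derivative at `t` of the map `f : [0,1] → A` (one-sided at the end points):
the difference quotients `(f s - f t) / (s - t)` tend to `a` as `s → t`, `s ≠ t`. -/
def HasDerivI [TopologicalSpace A] (f : I → A) (a : A) (t : I) : Prop :=
  Tendsto (fun s : I => (((s : ℝ) - (t : ℝ) : ℝ) : 𝕜)⁻¹ • (f s - f t)) (𝓝[≠] t) (𝓝 a)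

/-- `f : [0,1] → A` is smooth: it has derivatives `f = f⁽⁰⁾, f⁽¹⁾, f⁽²⁾, …` of all orders. -/
def IsSmooth [TopologicalSpace A] (f : I → A) : Prop :=
  ∃ F : ℕ → I → A, F 0 = f ∧ ∀ k t, HasDerivI 𝕜 (F k) (F (k + 1) t) t

variable {𝕜}

theorem HasDerivI.unique [TopologicalSpace A] [T2Space A] {f : I → A} {a b : A} {t : I}
    (ha : HasDerivI 𝕜 f a t) (hb : HasDerivI 𝕜 f b t) : a = b :=
  tendsto_nhds_unique ha hb

section Top
variable [TopologicalSpace A] [IsTopologicalAddGroup A] [ContinuousSMul 𝕜 A]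

theorem hasDerivI_const (a : A) (t : I) : HasDerivI 𝕜 (fun _ => a) 0 t := by
  simp [HasDerivI, tendsto_const_nhds]

theorem HasDerivI.add {f g : I → A} {a b : A} {t : I}
    (hf : HasDerivI 𝕜 f a t) (hg : HasDerivI 𝕜 g b t) : HasDerivI 𝕜 (f + g) (a + b) t := by
  refine (Tendsto.add hf hg).congr fun s => ?_
  rw [← smul_add, Pi.add_apply, Pi.add_apply]
  congr 1
  abel

theorem HasDerivI.smul {f : I → A} {a : A} {t : I} (c : 𝕜)
    (hf : HasDerivI 𝕜 f a t) : HasDerivI 𝕜 (c • f) (c • a) t := by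
  refine (Tendsto.const_smul hf c).congr fun s => ?_
  rw [Pi.smul_apply, Pi.smul_apply, ← smul_sub, smul_comm]

theorem HasDerivI.continuousAt {f : I → A} {a : A} {t : I} (hf : HasDerivI 𝕜 f a t) :
    ContinuousAt f t := by
  have h1 : Tendsto (fun s : I => (((s : ℝ) - (t : ℝ) : ℝ) : 𝕜)) (𝓝[≠] t) (𝓝 0) := by
    have : Continuous (fun s : I => (((s : ℝ) - (t : ℝ) : ℝ) : 𝕜)) := by fun_prop
    simpa using (this.tendsto t).mono_left nhdsWithin_le_nhds
  have h2 := h1.smul hf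
  rw [zero_smul] at h2
  have h3 : Tendsto (fun s => f s - f t) (𝓝[≠] t) (𝓝 0) := by
    refine h2.congr' ?_
    filter_upwards [self_mem_nhdsWithin] with s hs
    have : (((s : ℝ) - (t : ℝ) : ℝ) : 𝕜) ≠ 0 := by
      rw [Ne, RCLike.ofReal_eq_zero, sub_eq_zero]
      exact fun h => hs (Subtype.ext h)
    rw [smul_smul, mul_inv_cancel₀ this, one_smul]
  rw [← continuousWithinAt_compl_self, ContinuousWithinAt]
  simpa using h3.add_const (f t)

theorem HasDerivI.mul [IsScalarTower 𝕜 A A] [SMulCommClass 𝕜 A A] [ContinuousMul A]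
    {f g : I → A} {a b : A} {t : I}
    (hf : HasDerivI 𝕜 f a t) (hg : HasDerivI 𝕜 g b t) :
    HasDerivI 𝕜 (f * g) (a * g t + f t * b) t := by
  have hg' : Tendsto g (𝓝[≠] t) (𝓝 (g t)) := hg.continuousAt.mono_left nhdsWithin_le_nhds
  refine ((Tendsto.mul hf hg').add (Tendsto.const_mul (f t) hg)).congr fun s => ?_
  rw [smul_mul_assoc, mul_smul_comm, ← smul_add, Pi.mul_apply, Pi.mul_apply]
  congr 1
  noncomm_ring

theorem HasDerivI.comp_linear {B : Type*} [NonUnitalRing B] [Module 𝕜 B] [TopologicalSpace B]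
    (φ : A →ₙₐ[𝕜] B) (hφ : Continuous φ) {f : I → A} {a : A} {t : I}
    (hf : HasDerivI 𝕜 f a t) : HasDerivI 𝕜 (φ ∘ f) (φ a) t := by
  refine ((hφ.tendsto a).comp hf).congr fun s => ?_
  simp [map_smul, map_sub]

theorem IsSmooth.continuous {f : I → A} (hf : IsSmooth 𝕜 f) : Continuous f := by
  obtain ⟨F, rfl, hF⟩ := hf
  exact continuous_iff_continuousAt.2 fun t => (hF 0 t).continuousAt

/-- A set of maps that is closed under differentiation consists of smooth maps. -/
theorem isSmooth_of_closed (S : Set (I → A))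
    (hS : ∀ f ∈ S, ∃ g ∈ S, ∀ t, HasDerivI 𝕜 f (g t) t) {f : I → A} (hf : f ∈ S) :
    IsSmooth 𝕜 f := by
  choose! d hd hd' using hS
  have hmem : ∀ k, d^[k] f ∈ S := by
    intro k
    induction k with
    | zero => exact hf
    | succ k ih => rw [Function.iterate_succ_apply']; exact hd _ ih
  exact ⟨fun k => d^[k] f, rfl, fun k t => by
    simp only [Function.iterate_succ_apply']; exact hd' _ (hmem k) t⟩

theorem IsSmooth.exists_deriv {f : I → A} (hf : IsSmooth 𝕜 f) :
    ∃ g, IsSmooth 𝕜 g ∧ ∀ t, HasDerivI 𝕜 f (g t) t := by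
  obtain ⟨F, rfl, hF⟩ := hf
  exact ⟨F 1, ⟨fun k => F (k + 1), rfl, fun k t => hF (k + 1) t⟩, hF 0⟩

theorem isSmooth_const (a : A) : IsSmooth 𝕜 (fun _ : I => a) :=
  isSmooth_of_closed {f | ∃ a, f = fun _ => a}
    (by rintro _ ⟨a, rfl⟩; exact ⟨_, ⟨0, rfl⟩, hasDerivI_const a⟩) ⟨a, rfl⟩

theorem IsSmooth.add {f g : I → A} (hf : IsSmooth 𝕜 f) (hg : IsSmooth 𝕜 g) :
    IsSmooth 𝕜 (f + g) := by
  obtain ⟨F, rfl, hF⟩ := hf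
  obtain ⟨G, rfl, hG⟩ := hg
  exact ⟨fun k => F k + G k, rfl, fun k t => (hF k t).add (hG k t)⟩

theorem IsSmooth.smul {f : I → A} (c : 𝕜) (hf : IsSmooth 𝕜 f) : IsSmooth 𝕜 (c • f) := by
  obtain ⟨F, rfl, hF⟩ := hf
  exact ⟨fun k => c • F k, rfl, fun k t => (hF k t).smul c⟩

theorem IsSmooth.mul [IsScalarTower 𝕜 A A] [SMulCommClass 𝕜 A A] [ContinuousMul A]
    {f g : I → A} (hf : IsSmooth 𝕜 f) (hg : IsSmooth 𝕜 g) : IsSmooth 𝕜 (f * g) := by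
  let P : Set (I → A) := {h | ∃ f g, IsSmooth 𝕜 f ∧ IsSmooth 𝕜 g ∧ h = f * g}
  refine isSmooth_of_closed (AddSubmonoid.closure P : Set (I → A)) ?_
    (AddSubmonoid.subset_closure ⟨f, g, hf, hg, rfl⟩)
  intro h hh
  induction hh using AddSubmonoid.closure_induction with
  | mem x hx =>
    obtain ⟨f, g, hf, hg, rfl⟩ := hx
    obtain ⟨f', hf', hff'⟩ := hf.exists_deriv
    obtain ⟨g', hg', hgg'⟩ := hg.exists_deriv
    exact ⟨f' * g + f * g', add_mem (AddSubmonoid.subset_closure ⟨f', g, hf', hg, rfl⟩)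
      (AddSubmonoid.subset_closure ⟨f, g', hf, hg', rfl⟩), fun t => (hff' t).mul (hgg' t)⟩
  | zero => exact ⟨0, zero_mem _, fun t => hasDerivI_const 0 t⟩
  | add x y _ _ hx hy =>
    obtain ⟨x', hx', hxx'⟩ := hx
    obtain ⟨y', hy', hyy'⟩ := hy
    exact ⟨x' + y', add_mem hx' hy', fun t => (hxx' t).add (hyy' t)⟩

theorem IsSmooth.comp_linear {B : Type*} [NonUnitalRing B] [Module 𝕜 B] [TopologicalSpace B]
    (φ : A →ₙₐ[𝕜] B) (hφ : Continuous φ) {f : I → A} (hf : IsSmooth 𝕜 f) :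
    IsSmooth 𝕜 (φ ∘ f) := by
  obtain ⟨F, rfl, hF⟩ := hf
  exact ⟨fun k => φ ∘ F k, rfl, fun k t => (hF k t).comp_linear φ hφ⟩

end Top

section MeanValue
variable [TopologicalSpace A] [IsTopologicalAddGroup A] [ContinuousSMul 𝕜 A]

theorem seminorm_sub_le_of_le (p : Seminorm 𝕜 A) (hp : Continuous p) {f g : I → A}
    (hfg : ∀ t, HasDerivI 𝕜 f (g t) t) (c : A) (C : ℝ) {a b : I} (hab : a ≤ b)
    (hC : ∀ x : I, a ≤ x → x ≤ b → p (g x - c) ≤ C) :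
    p (f b - f a - (((b : ℝ) - a : ℝ) : 𝕜) • c) ≤ C * ((b : ℝ) - a) := by
  have hf : Continuous f := continuous_iff_continuousAt.2 fun t => (hfg t).continuousAt
  let pr : ℝ → I := Set.projIcc 0 1 zero_le_one
  have hpr : ∀ x : I, pr x = x := fun x => Set.projIcc_val zero_le_one x
  have hprc : Continuous pr := continuous_projIcc
  have key := image_le_of_liminf_slope_right_le_deriv_boundary
    (f := fun x : ℝ => p (f (pr x) - f a - ((x - a : ℝ) : 𝕜) • c)) (a := a) (b := b)
    (by
      apply Continuous.continuousOn
      apply hp.comp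
      fun_prop)
    (B := fun x => C * (x - a)) (B' := fun _ => C) (by simp [hpr])
    (by fun_prop)
    (fun x _ => by
      simpa using (((hasDerivAt_id x).sub_const (a : ℝ)).const_mul C).hasDerivWithinAt)
    (by
      rintro x ⟨hx1, hx2⟩ r hr
      have hxI : x ∈ I := ⟨a.2.1.trans hx1, hx2.le.trans b.2.2⟩
      have hxr : pr x = ⟨x, hxI⟩ := hpr ⟨x, hxI⟩
      have hlim : Tendsto (fun z : ℝ =>
          p ((((z - x : ℝ) : 𝕜)⁻¹) • (f (pr z) - f (pr x)) - c)) (𝓝[>] x)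
          (𝓝 (p (g ⟨x, hxI⟩ - c))) := by
        have h1 : Tendsto pr (𝓝[>] x) (𝓝[≠] (⟨x, hxI⟩ : I)) := by
          refine tendsto_nhdsWithin_iff.2 ⟨?_, ?_⟩
          · rw [← hxr]
            exact (hprc.tendsto x).mono_left nhdsWithin_le_nhds
          · filter_upwards [Ioo_mem_nhdsGT hx2] with z hz
            have hzI : z ∈ I := ⟨hxI.1.trans hz.1.le, hz.2.le.trans b.2.2⟩
            rw [show pr z = ⟨z, hzI⟩ from hpr ⟨z, hzI⟩]
            simpa using fun h : z = x => hz.1.ne' h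
        have h2 := ((hfg ⟨x, hxI⟩).comp h1).sub_const c
        refine ((hp.tendsto _).comp h2).congr' ?_
        filter_upwards [Ioo_mem_nhdsGT hx2] with z hz
        have hzI : z ∈ I := ⟨hxI.1.trans hz.1.le, hz.2.le.trans b.2.2⟩
        simp only [Function.comp_apply]
        rw [show pr z = ⟨z, hzI⟩ from hpr ⟨z, hzI⟩, hxr]
      have hev := hlim.eventually (gt_mem_nhds
        ((hC ⟨x, hxI⟩ hx1 hx2.le).trans_lt hr))
      refine Eventually.frequently ?_
      filter_upwards [hev, self_mem_nhdsWithin] with z hz hzx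
      have hzx : x < z := hzx
      have hpos : 0 < z - x := sub_pos.2 hzx
      refine lt_of_le_of_lt ?_ hz
      rw [slope_def_field, div_le_iff₀ hpos]
      have e : p ((((z - x : ℝ) : 𝕜)⁻¹) • (f (pr z) - f (pr x)) - c) * (z - x)
          = p ((f (pr z) - f a - ((z - a : ℝ) : 𝕜) • c)
            - (f (pr x) - f a - ((x - a : ℝ) : 𝕜) • c)) := by
        have hne : ((z - x : ℝ) : 𝕜) ≠ 0 := by
          rw [Ne, RCLike.ofReal_eq_zero]; exact hpos.ne'
        have : (f (pr z) - f a - ((z - a : ℝ) : 𝕜) • c)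
            - (f (pr x) - f a - ((x - a : ℝ) : 𝕜) • c)
            = ((z - x : ℝ) : 𝕜) • ((((z - x : ℝ) : 𝕜)⁻¹) • (f (pr z) - f (pr x)) - c) := by
          rw [smul_sub, smul_smul, mul_inv_cancel₀ hne, one_smul]
          have : ((z - a : ℝ) : 𝕜) • c = ((z - x : ℝ) : 𝕜) • c + ((x - a : ℝ) : 𝕜) • c := by
            rw [← add_smul]; congr 1; push_cast; ring
          rw [this]; abel
        rw [this, map_smul_eq_mul, RCLike.norm_ofReal, abs_of_pos hpos, mul_comm]
      rw [e]
      have h3 := map_add_le_add p ((f (pr z) - f a - ((z - a : ℝ) : 𝕜) • c)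
        - (f (pr x) - f a - ((x - a : ℝ) : 𝕜) • c)) (f (pr x) - f a - ((x - a : ℝ) : 𝕜) • c)
      rw [sub_add_cancel] at h3
      exact sub_le_iff_le_add.2 h3) (Set.right_mem_Icc.2 (show (a : ℝ) ≤ b from hab))
  simpa [hpr] using key

/-- The segment from `t` to `s`, as a map `[0,1] → [0,1]`. -/
def segI (t s : I) : C(I, I) where
  toFun u := ⟨t + u * ((s : ℝ) - t), by
    obtain ⟨u, hu0, hu1⟩ := u
    obtain ⟨t, ht0, ht1⟩ := t
    obtain ⟨s, hs0, hs1⟩ := s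
    constructor
    · change 0 ≤ t + u * (s - t); nlinarith [mul_nonneg hu0 hs0, mul_nonneg (sub_nonneg.2 hu1) ht0]
    · change t + u * (s - t) ≤ 1
      nlinarith [mul_nonneg hu0 (sub_nonneg.2 hs1),
        mul_nonneg (sub_nonneg.2 hu1) (sub_nonneg.2 ht1)]⟩
  continuous_toFun := by fun_prop

/-- The sup of `p (g x - g t)` over `x` in the segment from `t` to `s`. -/
def oscI (p : Seminorm 𝕜 A) (hp : Continuous p) (t s : I) (g : C(I, A)) : ℝ :=
  ‖(((ContinuousMap.mk p hp).comp (g - ContinuousMap.const I (g t))).comp (segI t s) : C(I, ℝ))‖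

theorem continuous_oscI (p : Seminorm 𝕜 A) (hp : Continuous p) (t s : I) :
    Continuous (oscI p hp t s) := by
  refine continuous_norm.comp ?_
  refine (ContinuousMap.continuous_precomp (segI t s)).comp ?_
  refine (ContinuousMap.continuous_postcomp (ContinuousMap.mk p hp)).comp ?_
  exact continuous_id.sub (ContinuousMap.continuous_const'.comp (continuous_eval_const t))

theorem le_oscI (p : Seminorm 𝕜 A) (hp : Continuous p) (t s : I) (g : C(I, A)) (u : I) :
    p (g (segI t s u) - g t) ≤ oscI p hp t s g := by
  refine le_trans ?_ (ContinuousMap.norm_coe_le_norm _ u)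
  exact le_abs_self _

theorem oscI_nonneg (p : Seminorm 𝕜 A) (hp : Continuous p) (t s : I) (g : C(I, A)) :
    0 ≤ oscI p hp t s g :=
  (apply_nonneg p _).trans (le_oscI p hp t s g 0)

theorem hasDerivI_iff_oscI [PolynormableSpace 𝕜 A] (f g : C(I, A)) :
    (∀ t, HasDerivI 𝕜 f (g t) t) ↔ ∀ (p : {p : Seminorm 𝕜 A // Continuous p}) (t s : I),
      p.1 (f s - f t - (((s : ℝ) - t : ℝ) : 𝕜) • g t)
        ≤ oscI p.1 p.2 t s g * |(s : ℝ) - t| := by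
  constructor
  · rintro h ⟨p, hp⟩ t s
    dsimp only
    rcases le_total t s with hts | hts
    · rw [abs_of_nonneg (sub_nonneg.2 (show (t : ℝ) ≤ s from hts))]
      refine seminorm_sub_le_of_le p hp h (g t) _ hts fun x h1 h2 => ?_
      rcases hts.eq_or_lt with rfl | hlt
      · obtain rfl : x = t := le_antisymm h2 h1
        simpa using oscI_nonneg p hp x x g
      · have hpos : (0 : ℝ) < (s : ℝ) - t := sub_pos.2 hlt
        have h1' : (t : ℝ) ≤ x := h1
        have h2' : (x : ℝ) ≤ s := h2
        convert! le_oscI p hp t s g ⟨((x : ℝ) - t) / (s - t),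
          div_nonneg (sub_nonneg.2 h1') hpos.le, (div_le_one hpos).2 (by linarith)⟩ using 4
        apply Subtype.ext
        change (x : ℝ) = t + ((x : ℝ) - t) / (s - t) * (s - t)
        field_simp; ring
    · have e : f s - f t - (((s : ℝ) - t : ℝ) : 𝕜) • g t
        = -(f t - f s - (((t : ℝ) - s : ℝ) : 𝕜) • g t) := by
        rw [← neg_sub (t : ℝ) s, RCLike.ofReal_neg, neg_smul]; abel
      rw [e, map_neg_eq_map, abs_sub_comm,
        abs_of_nonneg (sub_nonneg.2 (show (s : ℝ) ≤ t from hts))]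
      refine seminorm_sub_le_of_le p hp h (g t) _ hts fun x h1 h2 => ?_
      rcases hts.eq_or_lt with rfl | hlt
      · obtain rfl : x = s := le_antisymm h2 h1
        simpa using oscI_nonneg p hp x x g
      · have hpos : (0 : ℝ) < (t : ℝ) - s := sub_pos.2 hlt
        have h1' : (s : ℝ) ≤ x := h1
        have h2' : (x : ℝ) ≤ t := h2
        convert! le_oscI p hp t s g ⟨((t : ℝ) - x) / (t - s),
          div_nonneg (sub_nonneg.2 h2') hpos.le, (div_le_one hpos).2 (by linarith)⟩ using 4
        apply Subtype.ext
        change (x : ℝ) = t + ((t : ℝ) - x) / (t - s) * (s - t)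
        field_simp; ring
  · intro h t
    have hw := PolynormableSpace.withSeminorms 𝕜 A
    rw [HasDerivI, hw.tendsto_nhds]
    rintro ⟨p, hp⟩ ε hε
    have hcont : Tendsto (fun s => p (g s - g t)) (𝓝 t) (𝓝 0) := by
      have : Continuous fun s => p (g s - g t) := hp.comp (g.continuous.sub continuous_const)
      simpa using this.tendsto t
    obtain ⟨δ, hδ, hball⟩ := Metric.eventually_nhds_iff.1
      (hcont.eventually (gt_mem_nhds (half_pos hε)))
    filter_upwards [self_mem_nhdsWithin, nhdsWithin_le_nhds (Metric.ball_mem_nhds t hδ)]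
      with s hst hs
    have hne : (s : ℝ) - t ≠ 0 := by
      rw [Ne, sub_eq_zero]; exact fun h => hst (Subtype.ext h)
    have hosc : oscI p hp t s g ≤ ε / 2 := by
      refine (ContinuousMap.norm_le _ (half_pos hε).le).2 fun u => ?_
      change |p (g (segI t s u) - g t)| ≤ _
      rw [abs_of_nonneg (apply_nonneg _ _)]
      refine (hball ?_).le
      refine lt_of_le_of_lt ?_ hs
      rw [Subtype.dist_eq, Subtype.dist_eq, Real.dist_eq, Real.dist_eq]
      change |(t + u * ((s : ℝ) - t)) - t| ≤ _
      rw [add_sub_cancel_left, abs_mul, abs_of_nonneg u.2.1]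
      exact mul_le_of_le_one_left (abs_nonneg _) u.2.2
    have h1 := h ⟨p, hp⟩ t s
    have hne' : (((s : ℝ) - t : ℝ) : 𝕜) ≠ 0 := by
      rw [Ne, RCLike.ofReal_eq_zero]; exact hne
    have e : f s - f t - (((s : ℝ) - t : ℝ) : 𝕜) • g t
        = (((s : ℝ) - t : ℝ) : 𝕜) • ((((s : ℝ) - t : ℝ) : 𝕜)⁻¹ • (f s - f t) - g t) := by
      rw [smul_sub, smul_smul, mul_inv_cancel₀ hne', one_smul]
    dsimp only at h1
    rw [e, map_smul_eq_mul, RCLike.norm_ofReal, mul_comm] at h1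
    have h2 := le_of_mul_le_mul_right h1 (abs_pos.2 hne)
    linarith

theorem isClosed_hasDerivI [PolynormableSpace 𝕜 A] :
    IsClosed {q : C(I, A) × C(I, A) | ∀ t, HasDerivI 𝕜 q.1 (q.2 t) t} := by
  simp only [hasDerivI_iff_oscI, Set.ofPred_forall]
  refine isClosed_iInter fun p => isClosed_iInter fun t => isClosed_iInter fun s => ?_
  refine isClosed_le (p.2.comp ?_) (((continuous_oscI p.1 p.2 t s).comp continuous_snd).mul
    continuous_const)
  have h1 : ∀ r : I, Continuous fun q : C(I, A) × C(I, A) => q.1 r := fun r =>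
    (continuous_eval_const r).comp continuous_fst
  have h2 : ∀ r : I, Continuous fun q : C(I, A) × C(I, A) => q.2 r := fun r =>
    (continuous_eval_const r).comp continuous_snd
  exact ((h1 s).sub (h1 t)).sub ((h2 t).const_smul _)

end MeanValue

/-- The seminorm `f ↦ sup_x p (f x)`. -/
def supSeminorm (X : Type*) [TopologicalSpace X] [CompactSpace X]
    [TopologicalSpace A] [IsTopologicalAddGroup A] [ContinuousSMul 𝕜 A]
    (p : Seminorm 𝕜 A) (hp : Continuous p) : Seminorm 𝕜 C(X, A) :=
  Seminorm.of (fun f => ‖((ContinuousMap.mk p hp).comp f : C(X, ℝ))‖)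
    (fun f g => by
      refine (ContinuousMap.norm_le _ (by positivity)).2 fun x => ?_
      change |p (f x + g x)| ≤ _
      rw [abs_of_nonneg (apply_nonneg _ _)]
      refine (map_add_le_add p _ _).trans (add_le_add ?_ ?_)
      · exact (le_abs_self _).trans
          (ContinuousMap.norm_coe_le_norm ((ContinuousMap.mk p hp).comp f : C(X, ℝ)) x)
      · exact (le_abs_self _).trans
          (ContinuousMap.norm_coe_le_norm ((ContinuousMap.mk p hp).comp g : C(X, ℝ)) x))
    (fun c f => by
      have : ((ContinuousMap.mk p hp).comp (c • f) : C(X, ℝ))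
          = ‖c‖ • ((ContinuousMap.mk p hp).comp f : C(X, ℝ)) := by
        ext x
        exact map_smul_eq_mul p c (f x)
      rw [this, norm_smul, norm_norm])

instance polynormable_continuousMap {X : Type*} [TopologicalSpace X] [CompactSpace X]
    [UniformSpace A] [IsUniformAddGroup A] [ContinuousSMul 𝕜 A] [PolynormableSpace 𝕜 A] :
    PolynormableSpace 𝕜 C(X, A) := by
  have hw := PolynormableSpace.withSeminorms 𝕜 A
  let q : SeminormFamily 𝕜 C(X, A) {p : Seminorm 𝕜 A // Continuous p} :=
    fun p => supSeminorm X p.1 p.2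
  refine WithSeminorms.toPolynormableSpace (p := q) ?_
  rw [SeminormFamily.withSeminorms_iff_nhds_eq_iInf]
  apply le_antisymm
  · refine le_iInf fun p => ?_
    rw [← map_le_iff_le_comap]
    have : Continuous (q p) :=
      (continuous_norm (E := C(X, ℝ))).comp
        (ContinuousMap.continuous_postcomp (ContinuousMap.mk p.1 p.2))
    change Tendsto (q p) (𝓝 0) (𝓝 0)
    simpa using this.tendsto 0
  · rw [← tendsto_id', ContinuousMap.tendsto_iff_tendstoUniformly]
    intro U hU
    rw [uniformity_eq_comap_nhds_zero, mem_comap] at hU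
    obtain ⟨V, hV, hVU⟩ := hU
    obtain ⟨⟨s, r⟩, hr, hs⟩ := hw.hasBasis_zero_ball.mem_iff.1 hV
    have hev : ∀ᶠ f in ⨅ p, comap (q p) (𝓝 0), ∀ p ∈ s, q p f < r := by
      rw [eventually_all_finset]
      intro p _
      have : ∀ᶠ f in comap (q p) (𝓝 0), q p f < r :=
        (gt_mem_nhds hr).comap _
      exact this.filter_mono (iInf_le _ p)
    filter_upwards [hev] with f hf x
    apply hVU
    apply hs
    rw [Seminorm.mem_ball_zero]
    refine Seminorm.finset_sup_apply_lt hr fun p hp => ?_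
    refine lt_of_le_of_lt ?_ (hf p hp)
    have := (le_abs_self _).trans
      (ContinuousMap.norm_coe_le_norm ((ContinuousMap.mk p.1 p.2).comp f : C(X, ℝ)) x)
    simp only [ContinuousMap.zero_apply, sub_zero]
    exact this

theorem isUniformAddGroup_continuousMap [UniformSpace A] [IsUniformAddGroup A] :
    IsUniformAddGroup C(I, A) :=
  IsUniformInducing.isUniformAddGroup
    (AddMonoidHom.mk' (fun f : C(I, A) => UniformFun.ofFun (f : I → A)) fun _ _ => rfl)
    ContinuousMap.isUniformEmbedding_uniformFunOfFun.isUniformInducing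

end Calculus
section SmoothMap

variable (𝕜 : Type) [RCLike 𝕜] (A : Type u) [NonUnitalRing A] [Module 𝕜 A]
  [IsScalarTower 𝕜 A A] [SMulCommClass 𝕜 A A] [UniformSpace A] [IsUniformAddGroup A]
  [ContinuousSMul 𝕜 A] [ContinuousMul A]

/-- The smooth maps form a subalgebra of the algebra of all maps `[0,1] → A`. -/
def smoothMaps : NonUnitalSubalgebra 𝕜 (I → A) where
  carrier := {f | IsSmooth 𝕜 f}
  add_mem' := IsSmooth.add
  zero_mem' := isSmooth_const 0
  mul_mem' := IsSmooth.mul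
  smul_mem' c _ hf := hf.smul c

/-- The algebra `A^{∞(I)}` of smooth maps `[0,1] → A` with the pointwise operations. Its topology,
defined below, is not the topology of pointwise convergence. -/
def SmoothMap : Type u := smoothMaps 𝕜 A

namespace SmoothMap

instance : NonUnitalRing (SmoothMap 𝕜 A) := inferInstanceAs (NonUnitalRing (smoothMaps 𝕜 A))
instance : Module 𝕜 (SmoothMap 𝕜 A) := inferInstanceAs (Module 𝕜 (smoothMaps 𝕜 A))
instance : IsScalarTower 𝕜 (SmoothMap 𝕜 A) (SmoothMap 𝕜 A) :=
  inferInstanceAs (IsScalarTower 𝕜 (smoothMaps 𝕜 A) (smoothMaps 𝕜 A))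
instance : SMulCommClass 𝕜 (SmoothMap 𝕜 A) (SmoothMap 𝕜 A) :=
  inferInstanceAs (SMulCommClass 𝕜 (smoothMaps 𝕜 A) (smoothMaps 𝕜 A))

variable {𝕜 A}

instance : CoeFun (SmoothMap 𝕜 A) fun _ => I → A := ⟨fun f => f.1⟩

theorem isSmooth (f : SmoothMap 𝕜 A) : IsSmooth 𝕜 (f : I → A) := f.2

@[ext] theorem ext {f g : SmoothMap 𝕜 A} (h : ∀ t, f t = g t) : f = g := Subtype.ext (funext h)

@[simp] theorem add_apply (f g : SmoothMap 𝕜 A) (t : I) : (f + g) t = f t + g t := rfl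
@[simp] theorem mul_apply (f g : SmoothMap 𝕜 A) (t : I) : (f * g) t = f t * g t := rfl
@[simp] theorem zero_apply (t : I) : (0 : SmoothMap 𝕜 A) t = 0 := rfl
@[simp] theorem smul_apply (c : 𝕜) (f : SmoothMap 𝕜 A) (t : I) : (c • f) t = c • f t := rfl

theorem continuous_coe (f : SmoothMap 𝕜 A) : Continuous (f : I → A) := f.isSmooth.continuous

variable [T2Space A]

/-- Differentiation `f ↦ f'` on the smooth maps. -/
def deriv : SmoothMap 𝕜 A →ₗ[𝕜] SmoothMap 𝕜 A where
  toFun f := ⟨f.isSmooth.exists_deriv.choose, f.isSmooth.exists_deriv.choose_spec.1⟩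
  map_add' f g := ext fun t => ((f + g).isSmooth.exists_deriv.choose_spec.2 t).unique
    ((f.isSmooth.exists_deriv.choose_spec.2 t).add (g.isSmooth.exists_deriv.choose_spec.2 t))
  map_smul' c f := ext fun t => ((c • f).isSmooth.exists_deriv.choose_spec.2 t).unique
    ((f.isSmooth.exists_deriv.choose_spec.2 t).smul c)

theorem hasDerivI_deriv (f : SmoothMap 𝕜 A) (t : I) : HasDerivI 𝕜 f (deriv f t) t :=
  f.isSmooth.exists_deriv.choose_spec.2 t

theorem deriv_eq {f g : SmoothMap 𝕜 A} (h : ∀ t, HasDerivI 𝕜 f (g t) t) : deriv f = g :=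
  ext fun t => (hasDerivI_deriv f t).unique (h t)

theorem deriv_mul (f g : SmoothMap 𝕜 A) : deriv (f * g) = deriv f * g + f * deriv g :=
  deriv_eq fun t => (hasDerivI_deriv f t).mul (hasDerivI_deriv g t)

/-- A smooth map as a continuous map. -/
def toC : SmoothMap 𝕜 A →ₗ[𝕜] C(I, A) where
  toFun f := ⟨f, f.continuous_coe⟩
  map_add' _ _ := rfl
  map_smul' _ _ := rfl

/-- The sequence `(f, f', f'', …)` of all derivatives of a smooth map. -/
def jet : SmoothMap 𝕜 A →ₗ[𝕜] (ℕ → C(I, A)) :=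
  LinearMap.pi fun k => toC ∘ₗ (deriv ^ k)

/-- The topology (and uniformity) of `A^{∞(I)}`: uniform convergence on `[0,1]` of the maps and of
each of their derivatives. It is given by the seminorms `f ↦ sup_t ∑_{k ≤ r} p (f⁽ᵏ⁾ t)`, where `p`
runs through the continuous seminorms of `A` and `r` through `ℕ`. -/
instance : UniformSpace (SmoothMap 𝕜 A) := UniformSpace.comap jet inferInstance

theorem isUniformInducing_jet : IsUniformInducing (jet : SmoothMap 𝕜 A → ℕ → C(I, A)) := ⟨rfl⟩

theorem isInducing_jet : IsInducing (jet : SmoothMap 𝕜 A → ℕ → C(I, A)) :=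
  isUniformInducing_jet.isInducing

theorem jet_zero (f : SmoothMap 𝕜 A) (t : I) : jet f 0 t = f t := rfl

theorem jet_deriv (f : SmoothMap 𝕜 A) (k : ℕ) : jet (deriv f) k = jet f (k + 1) := by
  change toC ((deriv ^ k) (deriv f)) = toC ((deriv ^ (k + 1)) f)
  rw [pow_succ]; rfl

theorem hasDerivI_jet (f : SmoothMap 𝕜 A) (k : ℕ) (t : I) :
    HasDerivI 𝕜 (jet f k) (jet f (k + 1) t) t := by
  have := hasDerivI_deriv ((deriv ^ k) f) t
  change HasDerivI 𝕜 ((deriv ^ k) f) ((deriv ^ (k + 1)) f t) t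
  rw [pow_succ']
  exact this

theorem jet_injective : Function.Injective (jet : SmoothMap 𝕜 A → ℕ → C(I, A)) := by
  intro f g h
  ext t
  rw [← jet_zero, h, jet_zero]

theorem range_jet : Set.range (jet : SmoothMap 𝕜 A → ℕ → C(I, A))
    = {F | ∀ k t, HasDerivI 𝕜 (F k) (F (k + 1) t) t} := by
  ext F
  constructor
  · rintro ⟨f, rfl⟩ k t
    exact hasDerivI_jet f k t
  · intro hF
    let f : ℕ → SmoothMap 𝕜 A := fun m =>
      ⟨F m, fun k => F (m + k), rfl, fun k t => hF (m + k) t⟩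
    have hf : ∀ m, deriv (f m) = f (m + 1) := fun m => deriv_eq (hF m)
    refine ⟨f 0, funext fun k => ?_⟩
    have : (deriv ^ k) (f 0) = f k := by
      induction k with
      | zero => rfl
      | succ k ih => rw [pow_succ', Module.End.mul_apply, ih, hf]
    change toC ((deriv ^ k) (f 0)) = F k
    rw [this]; rfl

instance : IsUniformAddGroup (SmoothMap 𝕜 A) :=
  haveI := isUniformAddGroup_continuousMap (A := A)
  IsUniformInducing.isUniformAddGroup jet ⟨rfl⟩

instance : T2Space (SmoothMap 𝕜 A) := (IsEmbedding.mk isInducing_jet jet_injective).t2Space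

instance : ContinuousSMul 𝕜 (SmoothMap 𝕜 A) :=
  isInducing_jet.continuousSMul continuous_id fun {c x} => map_smul jet c x

theorem continuous_jet_apply (k : ℕ) : Continuous fun f : SmoothMap 𝕜 A => jet f k :=
  (continuous_apply k).comp isInducing_jet.continuous

theorem continuous_deriv : Continuous (deriv : SmoothMap 𝕜 A → SmoothMap 𝕜 A) := by
  rw [isInducing_jet.continuous_iff]
  refine continuous_pi fun k => ?_
  simp only [Function.comp_def, jet_deriv]
  exact continuous_jet_apply (k + 1)

instance : ContinuousMul (SmoothMap 𝕜 A) where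
  continuous_mul := by
    rw [isInducing_jet.continuous_iff]
    refine continuous_pi fun k => ?_
    change Continuous fun q : SmoothMap 𝕜 A × SmoothMap 𝕜 A => jet (q.1 * q.2) k
    induction k with
    | zero =>
      have h := (continuous_jet_apply (𝕜 := 𝕜) (A := A) 0)
      exact (h.comp continuous_fst).mul (h.comp continuous_snd)
    | succ k ih =>
      simp only [← jet_deriv, deriv_mul, map_add, Pi.add_apply]
      exact (ih.comp (continuous_deriv.prodMap continuous_id)).add
        (ih.comp (continuous_id.prodMap continuous_deriv))

instance [PolynormableSpace 𝕜 A] : PolynormableSpace 𝕜 (SmoothMap 𝕜 A) :=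
  IsInducing.polynormableSpace (𝕜₂ := 𝕜) (f := jet) isInducing_jet

instance [PolynormableSpace 𝕜 A] [CompleteSpace A] : CompleteSpace (SmoothMap 𝕜 A) := by
  refine isUniformInducing_jet.completeSpace ?_
  refine IsClosed.isComplete ?_
  rw [range_jet, Set.ofPred_forall]
  refine isClosed_iInter fun k => ?_
  have hc : Continuous fun F : ℕ → C(I, A) => (F k, F (k + 1)) :=
    (continuous_apply k).prodMk (continuous_apply (k + 1))
  exact (isClosed_hasDerivI (𝕜 := 𝕜) (A := A)).preimage hc

/-- Evaluation `f ↦ f t`. -/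
def eval (t : I) : SmoothMap 𝕜 A →ₙₐ[𝕜] A where
  toFun f := f t
  map_smul' _ _ := rfl
  map_zero' := rfl
  map_add' _ _ := rfl
  map_mul' _ _ := rfl

theorem continuous_eval (t : I) : Continuous (eval t : SmoothMap 𝕜 A → A) :=
  (continuous_eval_const t).comp (continuous_jet_apply 0)

/-- The inclusion of `A` as the constant maps. -/
def const : A →ₙₐ[𝕜] SmoothMap 𝕜 A where
  toFun a := ⟨fun _ => a, isSmooth_const a⟩
  map_smul' _ _ := rfl
  map_zero' := rfl
  map_add' _ _ := rfl
  map_mul' _ _ := rfl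

theorem deriv_const (a : A) : deriv (const a : SmoothMap 𝕜 A) = 0 :=
  deriv_eq fun t => hasDerivI_const a t

theorem continuous_const : Continuous (const : A → SmoothMap 𝕜 A) := by
  rw [isInducing_jet.continuous_iff]
  refine continuous_pi fun k => ?_
  cases k with
  | zero => exact ContinuousMap.continuous_const'
  | succ k =>
    simp only [Function.comp_def, ← jet_deriv, deriv_const, map_zero]
    exact _root_.continuous_const

section Map
variable {B C : Type u} [NonUnitalRing B] [Module 𝕜 B]
  [IsScalarTower 𝕜 B B] [SMulCommClass 𝕜 B B] [UniformSpace B] [IsUniformAddGroup B]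
  [ContinuousSMul 𝕜 B] [ContinuousMul B] [T2Space B]

/-- The homomorphism `A^{∞(I)} → B^{∞(I)}`, `f ↦ φ ∘ f`, induced by a continuous homomorphism. -/
def map (φ : A →ₙₐ[𝕜] B) (hφ : Continuous φ) : SmoothMap 𝕜 A →ₙₐ[𝕜] SmoothMap 𝕜 B where
  toFun f := ⟨φ ∘ f, f.isSmooth.comp_linear φ hφ⟩
  map_smul' c f := ext fun t => map_smul φ c (f t)
  map_zero' := ext fun _ => map_zero φ
  map_add' f g := ext fun t => map_add φ (f t) (g t)
  map_mul' f g := ext fun t => map_mul φ (f t) (g t)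

theorem deriv_map (φ : A →ₙₐ[𝕜] B) (hφ : Continuous φ) (f : SmoothMap 𝕜 A) :
    deriv (map φ hφ f) = map φ hφ (deriv f) :=
  deriv_eq fun t => (hasDerivI_deriv f t).comp_linear φ hφ

theorem continuous_map (φ : A →ₙₐ[𝕜] B) (hφ : Continuous φ) : Continuous (map φ hφ) := by
  rw [isInducing_jet.continuous_iff]
  refine continuous_pi fun k => ?_
  have : ∀ f, jet (map φ hφ f) k = (ContinuousMap.mk φ hφ).comp (jet f k) := by
    induction k with
    | zero => exact fun f => rfl
    | succ k ih => intro f; rw [← jet_deriv, deriv_map, ih, jet_deriv]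
  simp only [Function.comp_def, this]
  exact (ContinuousMap.continuous_postcomp _).comp (continuous_jet_apply k)

end Map

variable (𝕜 A) in
/-- The subalgebra `𝓘(A) = {f ∈ A^{∞(I)} | f(0) = 0}`, the kernel of evaluation at `0`, with the
topology of a subspace of `A^{∞(I)}`. -/
def paths : NonUnitalSubalgebra 𝕜 (SmoothMap 𝕜 A) where
  carrier := {f | f 0 = 0}
  add_mem' {f g} hf hg := by simp_all
  zero_mem' := rfl
  mul_mem' {f g} hf hg := by simp_all
  smul_mem' c f hf := by simp_all

theorem isClosed_paths : IsClosed (paths 𝕜 A : Set (SmoothMap 𝕜 A)) :=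
  isClosed_singleton.preimage (continuous_eval (𝕜 := 𝕜) (A := A) 0)

instance : IsUniformAddGroup (paths 𝕜 A) :=
  IsUniformInducing.isUniformAddGroup (paths 𝕜 A).toNonUnitalSubring.subtype ⟨rfl⟩
instance : ContinuousSMul 𝕜 (paths 𝕜 A) :=
  IsInducing.subtypeVal.continuousSMul continuous_id fun {_ _} => rfl
instance : ContinuousMul (paths 𝕜 A) where
  continuous_mul := by
    rw [IsInducing.subtypeVal.continuous_iff]
    exact (continuous_subtype_val.comp continuous_fst).mul
      (continuous_subtype_val.comp continuous_snd)
instance [PolynormableSpace 𝕜 A] : PolynormableSpace 𝕜 (paths 𝕜 A) :=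
  IsInducing.polynormableSpace (𝕜₂ := 𝕜) (f := (paths 𝕜 A).toSubmodule.subtype)
    IsInducing.subtypeVal
instance [PolynormableSpace 𝕜 A] [CompleteSpace A] : CompleteSpace (paths 𝕜 A) :=
  isClosed_paths.completeSpace_coe

end SmoothMap

end SmoothMap
section GeneralLinear

section Stabilize
variable {R : Type u} {S : Type v} {T : Type w} [Ring R] [Ring S] [Ring T]

/-- The stabilization `M ↦ diag(M, 1)` from `m × m` to `n × n` matrices, `m ≤ n`. -/
def stabFun {m : ℕ} (n : ℕ) (M : Matrix (Fin m) (Fin m) R) : Matrix (Fin n) (Fin n) R :=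
  Matrix.of fun i j => if hij : (i : ℕ) < m ∧ (j : ℕ) < m then M ⟨i, hij.1⟩ ⟨j, hij.2⟩
    else if i = j then 1 else 0

theorem stabFun_apply {m n : ℕ} (M : Matrix (Fin m) (Fin m) R) (i j : Fin n) :
    stabFun n M i j = if hij : (i : ℕ) < m ∧ (j : ℕ) < m then M ⟨i, hij.1⟩ ⟨j, hij.2⟩
      else if i = j then 1 else 0 := rfl

/-- The stabilization as a homomorphism of monoids. -/
def stab {m n : ℕ} (h : m ≤ n) : Matrix (Fin m) (Fin m) R →* Matrix (Fin n) (Fin n) R where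
  toFun := stabFun n
  map_one' := by
    ext i j
    rw [stabFun_apply]
    by_cases hij : (i : ℕ) < m ∧ (j : ℕ) < m
    · simp [hij, Matrix.one_apply, Fin.ext_iff]
    · simp [hij, Matrix.one_apply]
  map_mul' M N := by
    ext i j
    rw [Matrix.mul_apply]
    simp only [stabFun_apply]
    by_cases hi : (i : ℕ) < m
    · rw [← Fintype.sum_of_injective (Fin.castLE h) (Fin.castLE_injective h)
        (fun k => M ⟨i, hi⟩ k * (if hj : (j : ℕ) < m then N k ⟨j, hj⟩ else 0))]
      · by_cases hj : (j : ℕ) < m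
        · simp [hi, hj, Matrix.mul_apply]
        · have : i ≠ j := fun e => hj (e ▸ hi)
          simp [hj, this]
      · intro k hk
        have hk' : ¬ (k : ℕ) < m := fun h' => hk ⟨⟨k, h'⟩, Fin.ext rfl⟩
        have : i ≠ k := fun e => hk' (e ▸ hi)
        simp [hk', this]
      · intro k
        by_cases hj : (j : ℕ) < m
        · simp [hi, hj]
        · have : Fin.castLE h k ≠ j := fun e => hj (by rw [← e]; exact k.2)
          simp [hj, this]
    · rw [Finset.sum_eq_single i]
      · simp [hi]
      · intro k _ hk
        simp [hi, hk.symm]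
      · simp

theorem stab_apply {m n : ℕ} (h : m ≤ n) (M : Matrix (Fin m) (Fin m) R) (i j : Fin n) :
    stab h M i j = if hij : (i : ℕ) < m ∧ (j : ℕ) < m then M ⟨i, hij.1⟩ ⟨j, hij.2⟩
      else if i = j then 1 else 0 := rfl

theorem stab_self {m : ℕ} (M : Matrix (Fin m) (Fin m) R) : stab le_rfl M = M := by
  ext i j
  simp [stab_apply]

theorem stab_stab {m n k : ℕ} (h : m ≤ n) (h' : n ≤ k) (M : Matrix (Fin m) (Fin m) R) :
    stab h' (stab h M) = stab (h.trans h') M := by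
  ext i j
  simp only [stab_apply, Fin.ext_iff]
  by_cases hi : (i : ℕ) < m <;> by_cases hj : (j : ℕ) < m
  · simp [hi, hj, hi.trans_le h, hj.trans_le h]
  all_goals simp [hi, hj]

theorem map_stab (f : R →+* S) {m n : ℕ} (h : m ≤ n) (M : Matrix (Fin m) (Fin m) R) :
    f.mapMatrix (stab h M) = stab h (f.mapMatrix M) := by
  ext i j
  simp only [stab_apply, RingHom.mapMatrix_apply, Matrix.map_apply]
  split_ifs <;> simp

variable (R) in
/-- The stabilization homomorphism `GL_m(R) → GL_n(R)`, `m ≤ n`. -/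
def stabGL (m n : ℕ) (h : m ≤ n) :
    Matrix.GeneralLinearGroup (Fin m) R →* Matrix.GeneralLinearGroup (Fin n) R :=
  Units.map (stab h)

instance directedSystem_stabGL : DirectedSystem
    (fun m => Matrix.GeneralLinearGroup (Fin m) R) (stabGL R · · ·) where
  map_self _ x := Units.ext (stab_self x.1)
  map_map _ _ _ h h' x := Units.ext (stab_stab h h' x.1)

variable (R) in
/-- The infinite general linear group `GL(R) = colim_m GL_m(R)` of a ring with unit. -/
def GLUnital : Type u :=
  DirectLimit (fun m => Matrix.GeneralLinearGroup (Fin m) R) (stabGL R)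

instance : Group (GLUnital R) := inferInstanceAs (Group (DirectLimit _ (stabGL R)))

/-- The class in `GL(R)` of an invertible `m × m` matrix. -/
def GLUnital.of (m : ℕ) : Matrix.GeneralLinearGroup (Fin m) R →* GLUnital R where
  toFun M := (⟦⟨m, M⟩⟧ : DirectLimit _ (stabGL R))
  map_one' := (DirectLimit.one_def (f := stabGL R) m).symm
  map_mul' x y := (DirectLimit.mul_def (f := stabGL R) m x y).symm

theorem GLUnital.of_stabGL {m n : ℕ} (h : m ≤ n) (M : Matrix.GeneralLinearGroup (Fin m) R) :
    GLUnital.of n (stabGL R m n h M) = GLUnital.of m M :=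
  DirectLimit.mk_apply (F := fun m => Matrix.GeneralLinearGroup (Fin m) R) (f := stabGL R) m n M h

theorem GLUnital.exists_of (x : GLUnital R) : ∃ m M, x = GLUnital.of m M :=
  DirectLimit.exists_eq_mk (f := stabGL R) x

theorem GLUnital.of_eq_one {m : ℕ} {M : Matrix.GeneralLinearGroup (Fin m) R}
    (h : GLUnital.of m M = 1) : ∃ n, ∃ h : m ≤ n, stabGL R m n h M = 1 := by
  rw [← map_one (GLUnital.of m)] at h
  obtain ⟨n, h1, h2, e⟩ := Quotient.eq.mp h
  exact ⟨n, h1, e.trans (map_one _)⟩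

/-- The homomorphism `GL_m(R) → GL_m(S)` induced by a ring homomorphism. -/
def mapGLm (f : R →+* S) (m : ℕ) :
    Matrix.GeneralLinearGroup (Fin m) R →* Matrix.GeneralLinearGroup (Fin m) S :=
  Units.map (f.mapMatrix : Matrix (Fin m) (Fin m) R →+* Matrix (Fin m) (Fin m) S).toMonoidHom

/-- The homomorphism `GL(R) → GL(S)` induced by a ring homomorphism. -/
def GLUnital.map (f : R →+* S) : GLUnital R →* GLUnital S where
  toFun := DirectLimit.map (stabGL R) (stabGL S) (fun m => mapGLm f m)
    fun _ _ h M => Units.ext (map_stab f h M.1).symm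
  map_one' := by
    rw [← map_one (GLUnital.of (R := R) 0), ← map_one (GLUnital.of (R := S) 0),
      ← map_one (mapGLm f 0)]
    rfl
  map_mul' x y := by
    revert x y
    refine DirectLimit.induction₂ (stabGL R) fun m M N => ?_
    change DirectLimit.map (stabGL R) (stabGL S) _ _ (GLUnital.of m M * GLUnital.of m N) =
      GLUnital.of m (mapGLm f m M) * GLUnital.of m (mapGLm f m N)
    rw [← map_mul, ← map_mul, ← map_mul]
    rfl

theorem GLUnital.map_of (f : R →+* S) (m : ℕ) (M : Matrix.GeneralLinearGroup (Fin m) R) :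
    GLUnital.map f (GLUnital.of m M) = GLUnital.of m (mapGLm f m M) := rfl

theorem GLUnital.map_id (x : GLUnital R) : GLUnital.map (RingHom.id R) x = x := by
  obtain ⟨m, M, rfl⟩ := x.exists_of
  rfl

theorem GLUnital.map_map (f : R →+* S) (g : S →+* T) (x : GLUnital R) :
    GLUnital.map g (GLUnital.map f x) = GLUnital.map (g.comp f) x := by
  obtain ⟨m, M, rfl⟩ := x.exists_of
  rfl

end Stabilize

section NonUnital

variable (𝕜 : Type) [RCLike 𝕜] (A : Type u) [NonUnitalRing A] [Module 𝕜 A]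
  [IsScalarTower 𝕜 A A] [SMulCommClass 𝕜 A A]

/-- The augmentation `A⁺ → k` of the algebra `A⁺ = A + k` with adjoined unit. -/
def aug : Unitization 𝕜 A →+* 𝕜 := (Unitization.fstHom 𝕜 A).toRingHom

/-- The general linear group `GL(A) = Ker (GL(A⁺) → GL(k))` of an algebra without unit. -/
def GenLin : Subgroup (GLUnital (Unitization 𝕜 A)) := (GLUnital.map (aug 𝕜 A)).ker

variable {𝕜 A}
variable {B : Type u} [NonUnitalRing B] [Module 𝕜 B]
  [IsScalarTower 𝕜 B B] [SMulCommClass 𝕜 B B] {C : Type u} [NonUnitalRing C] [Module 𝕜 C]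
  [IsScalarTower 𝕜 C C] [SMulCommClass 𝕜 C C]

/-- The homomorphism `A⁺ → B⁺`, `a + c ↦ φ a + c`, induced by a homomorphism `φ : A → B`. -/
def unitMap (φ : A →ₙₐ[𝕜] B) : Unitization 𝕜 A →+* Unitization 𝕜 B :=
  (Unitization.lift ((Unitization.inrNonUnitalAlgHom 𝕜 B).comp φ)).toRingHom

@[simp] theorem unitMap_fst (φ : A →ₙₐ[𝕜] B) (x : Unitization 𝕜 A) :
    (unitMap φ x).fst = x.fst := by
  simp [unitMap, Unitization.algebraMap_eq_inl]

@[simp] theorem unitMap_snd (φ : A →ₙₐ[𝕜] B) (x : Unitization 𝕜 A) :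
    (unitMap φ x).snd = φ x.snd := by
  simp [unitMap, Unitization.algebraMap_eq_inl]

theorem unitMap_id : unitMap (NonUnitalAlgHom.id 𝕜 A) = RingHom.id _ := by
  ext x <;> simp

theorem unitMap_comp (ψ : B →ₙₐ[𝕜] C) (φ : A →ₙₐ[𝕜] B) :
    unitMap (ψ.comp φ) = (unitMap ψ).comp (unitMap φ) := by
  ext x <;> simp

theorem aug_unitMap (φ : A →ₙₐ[𝕜] B) : (aug 𝕜 B).comp (unitMap φ) = aug 𝕜 A :=
  RingHom.ext fun x => unitMap_fst φ x

/-- The homomorphism `GL(A) → GL(B)` induced by a homomorphism `A → B`. -/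
def GenLin.map (φ : A →ₙₐ[𝕜] B) : GenLin 𝕜 A →* GenLin 𝕜 B :=
  ((GLUnital.map (unitMap φ)).comp (GenLin 𝕜 A).subtype).codRestrict (GenLin 𝕜 B) fun x => by
    change GLUnital.map _ (GLUnital.map _ x.1) = 1
    rw [GLUnital.map_map, aug_unitMap]
    exact x.2

theorem GenLin.map_coe (φ : A →ₙₐ[𝕜] B) (x : GenLin 𝕜 A) :
    (GenLin.map φ x : GLUnital (Unitization 𝕜 B)) = GLUnital.map (unitMap φ) x := rfl

theorem GenLin.map_id (x : GenLin 𝕜 A) : GenLin.map (NonUnitalAlgHom.id 𝕜 A) x = x :=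
  Subtype.ext (by rw [GenLin.map_coe, unitMap_id, GLUnital.map_id])

theorem GenLin.map_map (ψ : B →ₙₐ[𝕜] C) (φ : A →ₙₐ[𝕜] B) (x : GenLin 𝕜 A) :
    GenLin.map ψ (GenLin.map φ x) = GenLin.map (ψ.comp φ) x :=
  Subtype.ext (by rw [GenLin.map_coe, GenLin.map_coe, GLUnital.map_map, GenLin.map_coe, unitMap_comp])

theorem GenLin.map_zero (x : GenLin 𝕜 A) : GenLin.map (0 : A →ₙₐ[𝕜] B) x = 1 := by
  have h : unitMap (0 : A →ₙₐ[𝕜] B) = (algebraMap 𝕜 (Unitization 𝕜 B)).comp (aug 𝕜 A) := by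
    refine RingHom.ext fun z => Unitization.ext ?_ ?_
    · simp [aug, Unitization.algebraMap_eq_inl]
    · simp [aug, Unitization.algebraMap_eq_inl]
  have hx : GLUnital.map (aug 𝕜 A) x.1 = 1 := x.2
  refine Subtype.ext ?_
  rw [GenLin.map_coe, h, ← GLUnital.map_map, hx, map_one]
  rfl

/-- `GL` preserves kernels: if `j` identifies `A` with the kernel of `q`, then every element of the
kernel of `GL(q)` comes from `GL(A)`. -/
theorem GenLin.exists_of_map_eq_one (j : A →ₙₐ[𝕜] B) (q : B →ₙₐ[𝕜] C) (hj : Function.Injective j)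
    (hq : ∀ b, q b = 0 → ∃ a, j a = b) (x : GenLin 𝕜 B) (hx : GenLin.map q x = 1) :
    ∃ y : GenLin 𝕜 A, GenLin.map j y = x := by
  obtain ⟨m, M, hM⟩ := GLUnital.exists_of x.1
  have h1 : GLUnital.of m (mapGLm (unitMap q) m M) = 1 := by
    rw [← GLUnital.map_of, ← hM, ← GenLin.map_coe, hx]; rfl
  obtain ⟨n, h, h2⟩ := GLUnital.of_eq_one h1
  set N := stabGL _ m n h M with hN
  have hxN : x.1 = GLUnital.of n N := by rw [hN, GLUnital.of_stabGL, hM]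
  have hqN : mapGLm (unitMap q) n N = 1 := by
    rw [← h2]; exact Units.ext (map_stab (unitMap q) h M.1)
  have hinj : Function.Injective (unitMap j) := fun a b hab =>
    Unitization.ext (by simpa using congrArg (fun z => z.fst) hab)
      (hj (by simpa using congrArg (fun z => z.snd) hab))
  have hlift : ∀ P : Matrix (Fin n) (Fin n) (Unitization 𝕜 B),
      (unitMap q).mapMatrix P = 1 → ∃ Q, (unitMap j).mapMatrix Q = P := by
    intro P hP
    have : ∀ i k, ∃ z, unitMap j z = P i k := by
      intro i k
      have hik : unitMap q (P i k) = (1 : Matrix (Fin n) (Fin n) (Unitization 𝕜 C)) i k := by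
        rw [← hP]; rfl
      have h0 : q (P i k).snd = 0 := by
        rw [← unitMap_snd, hik, Matrix.one_apply]
        split_ifs <;> simp
      obtain ⟨a, ha⟩ := hq _ h0
      exact ⟨Unitization.inl (P i k).fst + Unitization.inr a, Unitization.ext (by simp)
        (by simp [ha])⟩
    choose Q hQ using this
    exact ⟨Matrix.of Q, Matrix.ext hQ⟩
  obtain ⟨Q, hQ⟩ := hlift N.1 (congrArg Units.val hqN)
  obtain ⟨Q', hQ'⟩ := hlift (N⁻¹).1 (by
    have : mapGLm (unitMap q) n N⁻¹ = 1 := by rw [map_inv, hqN, inv_one]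
    exact congrArg Units.val this)
  have hinjM : Function.Injective ((unitMap j).mapMatrix (m := Fin n)) := by
    intro U V h
    refine Matrix.ext fun i k => ?_
    exact hinj (congrFun (congrFun h i) k)
  let y : Matrix.GeneralLinearGroup (Fin n) (Unitization 𝕜 A) :=
    ⟨Q, Q', hinjM (by rw [map_mul, hQ, hQ', map_one]; exact N.mul_inv),
      hinjM (by rw [map_mul, hQ, hQ', map_one]; exact N.inv_mul)⟩
  have hy : mapGLm (unitMap j) n y = N := Units.ext hQ
  have hmap : GLUnital.map (unitMap j) (GLUnital.of n y) = x.1 := by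
    rw [GLUnital.map_of, hy, hxN]
  have hmem : GLUnital.of n y ∈ GenLin 𝕜 A := by
    change GLUnital.map _ _ = 1
    rw [← aug_unitMap j, ← GLUnital.map_map, hmap]
    exact x.2
  exact ⟨⟨GLUnital.of n y, hmem⟩, Subtype.ext hmap⟩

theorem GenLin.map_injective (j : A →ₙₐ[𝕜] B) (hj : Function.Injective j) :
    Function.Injective (GenLin.map j) := by
  rw [injective_iff_map_eq_one]
  intro x hx
  obtain ⟨m, M, hM⟩ := GLUnital.exists_of x.1
  have h1 : GLUnital.of m (mapGLm (unitMap j) m M) = 1 := by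
    rw [← GLUnital.map_of, ← hM, ← GenLin.map_coe, hx]; rfl
  obtain ⟨n, h, h2⟩ := GLUnital.of_eq_one h1
  have h3 : (unitMap j).mapMatrix (stab h M.1) = 1 := by
    rw [map_stab]; exact congrArg Units.val h2
  have hinj : Function.Injective (unitMap j) := fun a b hab =>
    Unitization.ext (by simpa using congrArg (fun z => z.fst) hab)
      (hj (by simpa using congrArg (fun z => z.snd) hab))
  have h4 : stab h M.1 = 1 := by
    refine Matrix.ext fun i k => hinj ?_
    have := congrFun (congrFun h3 i) k
    refine Eq.trans this ?_
    rw [Matrix.one_apply, Matrix.one_apply]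
    split_ifs
    · rw [map_one]
    · rw [_root_.map_zero]
  have h5 : stabGL _ m n h M = 1 := Units.ext h4
  refine Subtype.ext ?_
  rw [hM, ← GLUnital.of_stabGL h, h5, map_one]
  rfl

end NonUnital
end GeneralLinear

/-- The objects of the category `𝒜` of locally convex `𝕜`-algebras, `𝕜 = ℝ` or `ℂ`: associative
algebras, with or without unit, with a complete Hausdorff locally convex topology (given by a
family of seminorms) for which multiplication is jointly continuous. -/
structure LCAlg (𝕜 : Type) [RCLike 𝕜] : Type (u + 1) where
  /-- The underlying type. -/
  carrier : Type u
  [ring : NonUnitalRing carrier]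
  [module : Module 𝕜 carrier]
  [isScalarTower : IsScalarTower 𝕜 carrier carrier]
  [smulCommClass : SMulCommClass 𝕜 carrier carrier]
  [uniformSpace : UniformSpace carrier]
  [isUniformAddGroup : IsUniformAddGroup carrier]
  [continuousSMul : ContinuousSMul 𝕜 carrier]
  [continuousMul : ContinuousMul carrier]
  [polynormable : PolynormableSpace 𝕜 carrier]
  [t2Space : T2Space carrier]
  [completeSpace : CompleteSpace carrier]

namespace LCAlg

variable {𝕜 : Type} [RCLike 𝕜]

instance : CoeSort (LCAlg.{u} 𝕜) (Type u) := ⟨carrier⟩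

attribute [instance] ring module isScalarTower smulCommClass uniformSpace isUniformAddGroup
  continuousSMul continuousMul polynormable t2Space completeSpace

/-- The morphisms of `𝒜`: continuous `𝕜`-algebra homomorphisms. -/
@[ext] structure Hom (A B : LCAlg.{u} 𝕜) where
  /-- The underlying homomorphism. -/
  hom : A →ₙₐ[𝕜] B
  cont : Continuous hom

instance : Category (LCAlg.{u} 𝕜) where
  Hom := Hom
  id A := ⟨NonUnitalAlgHom.id 𝕜 A, continuous_id⟩
  comp f g := ⟨g.hom.comp f.hom, g.cont.comp f.cont⟩

@[ext] theorem hom_ext {A B : LCAlg.{u} 𝕜} {f g : A ⟶ B} (h : ∀ a, f.hom a = g.hom a) : f = g :=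
  Hom.ext (NonUnitalAlgHom.ext h)

end LCAlg

section Functors

variable (𝕜 : Type) [RCLike 𝕜]

/-- The functor `A ↦ A^{∞(I)}`. -/
def smoothF : LCAlg.{u} 𝕜 ⥤ LCAlg.{u} 𝕜 where
  obj A := LCAlg.mk (SmoothMap 𝕜 A)
  map f := ⟨SmoothMap.map f.hom f.cont, SmoothMap.continuous_map f.hom f.cont⟩

/-- The evaluation `ε_t : A^{∞(I)} → A`, `f ↦ f t`. -/
def ev (t : I) : smoothF.{u} 𝕜 ⟶ 𝟭 (LCAlg.{u} 𝕜) where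
  app A := ⟨SmoothMap.eval t, SmoothMap.continuous_eval t⟩

/-- The inclusion `A → A^{∞(I)}` as the constant maps. -/
def incl : 𝟭 (LCAlg.{u} 𝕜) ⟶ smoothF.{u} 𝕜 where
  app A := ⟨SmoothMap.const, SmoothMap.continuous_const⟩

variable {𝕜} in
/-- The restriction of `f^{∞(I)}` to a homomorphism `𝓘(A) → 𝓘(B)`. -/
def pathMap {A B : LCAlg.{u} 𝕜} (f : A ⟶ B) :
    SmoothMap.paths 𝕜 A →ₙₐ[𝕜] SmoothMap.paths 𝕜 B :=
  NonUnitalAlgHom.codRestrict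
    ((SmoothMap.map f.hom f.cont).comp (NonUnitalSubalgebraClass.subtype (SmoothMap.paths 𝕜 A)))
    (SmoothMap.paths 𝕜 B) fun x => by
      change f.hom (x.1 0) = 0
      rw [show x.1 0 = 0 from x.2, map_zero]

/-- The smooth path functor `A ↦ 𝓘(A) = Ker (ε₀ : A^{∞(I)} → A)`. -/
def pathF : LCAlg.{u} 𝕜 ⥤ LCAlg.{u} 𝕜 where
  obj A := LCAlg.mk (SmoothMap.paths 𝕜 A)
  map f := ⟨pathMap f, ((SmoothMap.continuous_map f.hom f.cont).comp
    continuous_subtype_val).subtype_mk _⟩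

/-- The inclusion `𝓘(A) → A^{∞(I)}`. -/
def pathIncl : pathF.{u} 𝕜 ⟶ smoothF.{u} 𝕜 where
  app A := ⟨NonUnitalSubalgebraClass.subtype (SmoothMap.paths 𝕜 A), continuous_subtype_val⟩

/-- `τ_A : 𝓘(A) → A`, the restriction of `ε₁`. -/
def tau : pathF.{u} 𝕜 ⟶ 𝟭 (LCAlg.{u} 𝕜) := pathIncl 𝕜 ≫ ev 𝕜 1

/-- The iterates `𝓘ⁿ` of the smooth path functor, `𝓘⁰(A) = A`. -/
def pathIter : ℕ → (LCAlg.{u} 𝕜 ⥤ LCAlg.{u} 𝕜)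
  | 0 => 𝟭 _
  | n + 1 => pathIter n ⋙ pathF 𝕜

/-- The face operators `𝓘ⁱ τ 𝓘ⁿ⁻ⁱ : 𝓘ⁿ⁺¹(A) → 𝓘ⁿ(A)`, `0 ≤ i ≤ n`, of the augmented simplicial
algebra `𝓘_*⁺(A)` of the smooth path cotriple. Here `𝓘ⁿ⁺¹(A)` is in degree `n`; for `n = 0` this is
the augmentation `τ_A : 𝓘(A) → A`, where `A` is in degree `-1`. -/
def face : (n : ℕ) → Fin (n + 1) → (pathIter.{u} 𝕜 (n + 1) ⟶ pathIter.{u} 𝕜 n)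
  | n, ⟨0, _⟩ => Functor.whiskerLeft (pathIter 𝕜 n) (tau 𝕜)
  | n + 1, ⟨i + 1, h⟩ => Functor.whiskerRight (face n ⟨i, Nat.lt_of_succ_lt_succ h⟩) (pathF 𝕜)

/-- The general linear group functor `A ↦ GL(A)`. -/
def glF : LCAlg.{u} 𝕜 ⥤ GrpCat.{u} where
  obj A := GrpCat.of (GenLin 𝕜 A)
  map f := GrpCat.ofHom (GenLin.map f.hom)
  map_id _ := GrpCat.hom_ext (MonoidHom.ext fun x => GenLin.map_id x)
  map_comp f g := GrpCat.hom_ext (MonoidHom.ext fun x => (GenLin.map_map g.hom f.hom x).symm)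

end Functors

section KTheory

variable {𝕜 : Type} [RCLike 𝕜]

/-- The group `GL(𝓘ⁿ(A))`; the component in degree `n - 1` of the augmented simplicial group
`GL(𝓘_*⁺(A))`. -/
abbrev glPath (n : ℕ) (A : LCAlg.{u} 𝕜) : Type u := (glF 𝕜).obj ((pathIter 𝕜 n).obj A)

/-- The face homomorphisms of the augmented simplicial group `GL(𝓘_*⁺(A))`. -/
def glFace (n : ℕ) (i : Fin (n + 1)) (A : LCAlg.{u} 𝕜) : glPath (n + 1) A →* glPath n A :=
  ((glF 𝕜).map ((face 𝕜 n i).app A)).hom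

/-- The homomorphism `GL(𝓘ⁿ(A)) → GL(𝓘ⁿ(B))` induced by `f : A → B`. -/
def glMap (n : ℕ) {A B : LCAlg.{u} 𝕜} (f : A ⟶ B) : glPath n A →* glPath n B :=
  ((glF 𝕜).map ((pathIter 𝕜 n).map f)).hom

/-- The cycles in degree `n - 1`: the elements of `GL(𝓘ⁿ(A))` on which all faces are trivial
(for `n = 0`, in degree `-1`, there are no faces). -/
def cycles : (n : ℕ) → (A : LCAlg.{u} 𝕜) → Subgroup (glPath n A)
  | 0, _ => ⊤
  | n + 1, A => ⨅ i : Fin (n + 1), (glFace n i A).ker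

/-- The Moore subgroup in degree `n`: the elements of `GL(𝓘ⁿ⁺¹(A))` on which all faces except the
zeroth one are trivial. -/
def moore (n : ℕ) (A : LCAlg.{u} 𝕜) : Subgroup (glPath (n + 1) A) :=
  ⨅ i : Fin n, (glFace n i.succ A).ker

/-- The boundaries in degree `n - 1`: the image of the Moore subgroup under the zeroth face. -/
def boundaries (n : ℕ) (A : LCAlg.{u} 𝕜) : Subgroup (glPath n A) :=
  (moore n A).map (glFace n 0 A)

theorem mem_moore {n : ℕ} {A : LCAlg.{u} 𝕜} {x : glPath (n + 1) A} :
    x ∈ moore n A ↔ ∀ i : Fin n, glFace n i.succ A x = 1 := by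
  simp only [moore, Subgroup.mem_iInf, MonoidHom.mem_ker]

theorem glF_comp_apply {A B C D : LCAlg.{u} 𝕜} {f : A ⟶ B} {g : B ⟶ D} {h : A ⟶ C} {k : C ⟶ D}
    (w : f ≫ g = h ≫ k) (x : (glF 𝕜).obj A) :
    ((glF 𝕜).map g).hom (((glF 𝕜).map f).hom x)
      = ((glF 𝕜).map k).hom (((glF 𝕜).map h).hom x) := by
  have e := congrArg (fun g => ((glF 𝕜).map g).hom x) w
  simp only [CategoryTheory.Functor.map_comp] at e
  exact e

theorem glFace_natural (n : ℕ) (i : Fin (n + 1)) {A B : LCAlg.{u} 𝕜} (f : A ⟶ B)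
    (x : glPath (n + 1) A) : glFace n i B (glMap (n + 1) f x) = glMap n f (glFace n i A x) :=
  glF_comp_apply ((face 𝕜 n i).naturality f) x

theorem face_zero_app (n : ℕ) (A : LCAlg.{u} 𝕜) :
    (face 𝕜 n 0).app A = (tau 𝕜).app ((pathIter 𝕜 n).obj A) := by
  cases n <;> rfl

theorem face_succ_app (n : ℕ) (i : Fin (n + 1)) (A : LCAlg.{u} 𝕜) :
    (face 𝕜 (n + 1) i.succ).app A = (pathF 𝕜).map ((face 𝕜 n i).app A) := rfl

/-- The simplicial identity `d_i d_0 = d_0 d_{i+1}`. -/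
theorem glFace_glFace_zero (n : ℕ) (i : Fin (n + 1)) (A : LCAlg.{u} 𝕜) (x : glPath (n + 2) A) :
    glFace n i A (glFace (n + 1) 0 A x) = glFace n 0 A (glFace (n + 1) i.succ A x) := by
  refine glF_comp_apply ?_ x
  rw [face_zero_app, face_zero_app, face_succ_app]
  exact ((tau 𝕜).naturality ((face 𝕜 n i).app A)).symm

theorem boundaries_le_cycles (n : ℕ) (A : LCAlg.{u} 𝕜) : boundaries n A ≤ cycles n A := by
  cases n with
  | zero => exact le_top
  | succ n =>
    rintro _ ⟨y, hy, rfl⟩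
    have hy := mem_moore.1 hy
    simp only [cycles, Subgroup.mem_iInf, MonoidHom.mem_ker]
    intro i
    rw [glFace_glFace_zero, hy, map_one]

/-- The homomorphism `GL(τ_X) : GL(𝓘(X)) → GL(X)`. -/
def glTau (X : LCAlg.{u} 𝕜) : (glF 𝕜).obj ((pathF 𝕜).obj X) →* (glF 𝕜).obj X :=
  ((glF 𝕜).map ((tau 𝕜).app X)).hom

/-- A path in `GL` starting at `1` can be conjugated by a constant path. -/
theorem exists_conj_path {X : LCAlg.{u} 𝕜} (g : (glF 𝕜).obj X) (y : (glF 𝕜).obj ((pathF 𝕜).obj X)) :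
    ∃ y' : (glF 𝕜).obj ((pathF 𝕜).obj X),
      glTau X y' = g * glTau X y * g⁻¹ ∧
      ∀ (Y : LCAlg.{u} 𝕜) (φ : X ⟶ Y), ((glF 𝕜).map ((pathF 𝕜).map φ)).hom y = 1 →
        ((glF 𝕜).map ((pathF 𝕜).map φ)).hom y' = 1 := by
  let c : (glF 𝕜).obj ((smoothF 𝕜).obj X) := ((glF 𝕜).map ((incl 𝕜).app X)).hom g
  let z : (glF 𝕜).obj ((smoothF 𝕜).obj X) := ((glF 𝕜).map ((pathIncl 𝕜).app X)).hom y
  have hc : ∀ t, ((glF 𝕜).map ((ev 𝕜 t).app X)).hom c = g := fun t => by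
    have : (incl 𝕜).app X ≫ (ev 𝕜 t).app X = 𝟙 X ≫ 𝟙 X := rfl
    rw [glF_comp_apply this]
    simp
  have hz0 : ((glF 𝕜).map ((ev 𝕜 0).app X)).hom z = 1 := by
    have e : ∀ p : (pathF 𝕜).obj X, ((ev 𝕜 0).app X).hom (((pathIncl 𝕜).app X).hom p) = 0 :=
      fun p => p.2
    have e' : ((ev 𝕜 0).app X).hom.comp ((pathIncl 𝕜).app X).hom = 0 :=
      NonUnitalAlgHom.ext e
    refine (GenLin.map_map ((ev 𝕜 0).app X).hom ((pathIncl 𝕜).app X).hom y).trans ?_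
    rw [e']
    exact GenLin.map_zero y
  have hz1 : ((glF 𝕜).map ((ev 𝕜 1).app X)).hom z = glTau X y :=
    GenLin.map_map _ _ y
  obtain ⟨y', hy'⟩ : ∃ y', ((glF 𝕜).map ((pathIncl 𝕜).app X)).hom y' = c * z * c⁻¹ :=
    GenLin.exists_of_map_eq_one ((pathIncl 𝕜).app X).hom
      ((ev 𝕜 0).app X).hom Subtype.val_injective (fun b hb => ⟨⟨b, hb⟩, rfl⟩) (c * z * c⁻¹) (by
        change ((glF 𝕜).map ((ev 𝕜 0).app X)).hom (c * z * c⁻¹) = 1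
        rw [map_mul, map_mul, hz0, map_inv, mul_one, mul_inv_cancel])
  refine ⟨y', ?_, fun Y φ hy => ?_⟩
  · have : glTau X y' = ((glF 𝕜).map ((ev 𝕜 1).app X)).hom
        (((glF 𝕜).map ((pathIncl 𝕜).app X)).hom y') := (GenLin.map_map _ _ y').symm
    rw [this, hy', map_mul, map_mul, map_inv, hc, hz1]
  · have hnat := fun x => glF_comp_apply ((pathIncl 𝕜).naturality φ) x
    have hz : ((glF 𝕜).map ((smoothF 𝕜).map φ)).hom z = 1 := by
      rw [← hnat, hy, map_one]
    have hinj : Function.Injective ((glF 𝕜).map ((pathIncl 𝕜).app Y)).hom :=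
      GenLin.map_injective ((pathIncl 𝕜).app Y).hom Subtype.val_injective
    apply hinj
    rw [hnat, hy', map_mul, map_mul, hz, map_inv, mul_one, mul_inv_cancel, map_one]

/-- The boundaries form a normal subgroup. -/
instance boundaries_normal (n : ℕ) (A : LCAlg.{u} 𝕜) : (boundaries n A).Normal where
  conj_mem := by
    rintro _ ⟨y, hy, rfl⟩ g
    obtain ⟨y', h1, h2⟩ := exists_conj_path (X := (pathIter 𝕜 n).obj A) g y
    have hy := mem_moore.1 hy
    refine ⟨y', mem_moore.2 ?_, ?_⟩
    · cases n with
      | zero => exact fun i => i.elim0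
      | succ k => exact fun i => h2 _ ((face 𝕜 k i).app A) (hy i)
    · rw [glFace, face_zero_app]
      exact h1

/-- The homotopy group `π_{n-1}` of the augmented simplicial group `GL(𝓘_*⁺(A))`, as the quotient
of the cycles by the boundaries (the homology of the Moore complex). -/
abbrev homotopyGroup (n : ℕ) (A : LCAlg.{u} 𝕜) : Type u :=
  cycles n A ⧸ (boundaries n A).subgroupOf (cycles n A)

theorem glMap_mem_cycles (n : ℕ) {A B : LCAlg.{u} 𝕜} (f : A ⟶ B) {x : glPath n A}
    (hx : x ∈ cycles n A) : glMap n f x ∈ cycles n B := by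
  cases n with
  | zero => trivial
  | succ n =>
    simp only [cycles, Subgroup.mem_iInf, MonoidHom.mem_ker] at hx ⊢
    intro i
    rw [glFace_natural, hx, map_one]

theorem glMap_mem_boundaries (n : ℕ) {A B : LCAlg.{u} 𝕜} (f : A ⟶ B) {x : glPath n A}
    (hx : x ∈ boundaries n A) : glMap n f x ∈ boundaries n B := by
  obtain ⟨y, hy, rfl⟩ := hx
  refine ⟨glMap (n + 1) f y, ?_, glFace_natural n 0 f y⟩
  refine mem_moore.2 fun i => ?_
  rw [glFace_natural, mem_moore.1 hy, map_one]

/-- The homomorphism induced by `f : A → B` on the cycles. -/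
def cyclesMap (n : ℕ) {A B : LCAlg.{u} 𝕜} (f : A ⟶ B) : cycles n A →* cycles n B :=
  ((glMap n f).comp (cycles n A).subtype).codRestrict (cycles n B)
    fun x => glMap_mem_cycles n f x.2

/-- The homomorphism induced by `f : A → B` on the homotopy groups. -/
def homotopyMap (n : ℕ) {A B : LCAlg.{u} 𝕜} (f : A ⟶ B) : homotopyGroup n A →* homotopyGroup n B :=
  QuotientGroup.map _ _ (cyclesMap n f) fun _ hx => glMap_mem_boundaries n f hx

variable (𝕜) in
/-- The functor `A ↦ π_{n-1} GL(𝓘_*⁺(A))`. -/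
def homotopyF (n : ℕ) : LCAlg.{u} 𝕜 ⥤ GrpCat.{u} where
  obj A := GrpCat.of (homotopyGroup n A)
  map f := GrpCat.ofHom (homotopyMap n f)
  map_id A := by
    refine GrpCat.hom_ext (MonoidHom.ext fun x => ?_)
    induction x using QuotientGroup.induction_on with
    | H x =>
      refine congrArg (QuotientGroup.mk (s := (boundaries n A).subgroupOf (cycles n A)))
        (Subtype.ext ?_)
      change ((glF 𝕜).map ((pathIter 𝕜 n).map (𝟙 A))).hom x.1 = x.1
      rw [CategoryTheory.Functor.map_id, CategoryTheory.Functor.map_id]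
      rfl
  map_comp {A B C} f g := by
    refine GrpCat.hom_ext (MonoidHom.ext fun x => ?_)
    induction x using QuotientGroup.induction_on with
    | H x =>
      refine congrArg (QuotientGroup.mk (s := (boundaries n C).subgroupOf (cycles n C)))
        (Subtype.ext ?_)
      change ((glF 𝕜).map ((pathIter 𝕜 n).map (f ≫ g))).hom x.1 = _
      rw [CategoryTheory.Functor.map_comp, CategoryTheory.Functor.map_comp]
      rfl

variable (𝕜) in
/-- The smooth `K`-functors `K_n^{sm}(A) = π_{n-2} GL(𝓘_*⁺(A))`, `n ≥ 1`. For `n = 1` this is the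
cokernel of `GL(τ_A) : GL(𝓘(A)) → GL(A)`. -/
def Ksm (n : ℕ+) : LCAlg.{u} 𝕜 ⥤ GrpCat.{u} := homotopyF 𝕜 n.natPred

/-- Two morphisms `f, g : A → B` of `𝒜` are smooth homotopic if there is a morphism
`h : A → B^{∞(I)}` with `ε₀ h = f` and `ε₁ h = g`. -/
def SmoothHomotopic {A B : LCAlg.{u} 𝕜} (f g : A ⟶ B) : Prop :=
  ∃ h : A ⟶ (smoothF 𝕜).obj B, h ≫ (ev 𝕜 0).app B = f ∧ h ≫ (ev 𝕜 1).app B = g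

/-- A functor `T : 𝒜 → Gr` is a smooth homotopy functor if `T(f) = T(g)` whenever `f` and `g` are
smooth homotopic. -/
def IsSmoothHomotopyFunctor (T : LCAlg.{u} 𝕜 ⥤ GrpCat.{u}) : Prop :=
  ∀ ⦃A B : LCAlg.{u} 𝕜⦄ (f g : A ⟶ B), SmoothHomotopic f g → T.map f = T.map g

end KTheory
end

end SmoothK

/-!
The heart of the matter is that `GL` turns a smooth homotopy into a path of the right kind, one
simplicial degree higher. Let `h : A → B^{∞(I)}` be a smooth homotopy and let `x ∈ GL(𝓘ⁿ(A))` be a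
cycle. Exchanging the homotopy parameter with the `n` path parameters gives a continuous
homomorphism `𝓘ⁿ(B^{∞(I)}) → 𝓘ⁿ(B)^{∞(I)}` (`iterSwap`), which is compatible with the evaluations
and with all faces (`iterSwap_ev`, `iterSwap_face`). So `h` carries `x` to an element `x'` of
`GL(𝓘ⁿ(B)^{∞(I)})` whose faces are trivial and whose values at `0` and `1` are the images of `x`
under the two ends `f`, `g` of the homotopy. The quotient of `x'` by the constant path at its
initial value starts at `1`; since `GL` preserves kernels, it is an element of `GL(𝓘ⁿ⁺¹(B))`
(`exists_path_div`). Its zeroth face is `g(x) f(x)⁻¹` and its other faces are trivial, so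
`g(x) f(x)⁻¹` is a boundary (`glMap_mul_inv_mem_boundaries`). No connecting homomorphism or long
exact sequence is needed.

The second assertion follows formally from the first: `ε₀` is a left inverse of the inclusion of
the constant maps, and the composition in the other order is homotopic to the identity by
`f ↦ (s ↦ (t ↦ f (s * t)))` (`smoothHomotopic_ev_incl`).

The analytic content is that the exchange of variables and this contraction take values in smooth
maps into `A^{∞(I)}`, with its topology of uniform convergence of all derivatives, and are
continuous. Smoothness rests on `SmoothMap.hasDerivI_of_pointwise`: a pointwise derivative in the
parameter is a derivative in `A^{∞(I)}` when it depends continuously on the parameter there. It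
combines the mean value inequality, which makes difference quotients converge uniformly, with the
closedness of differentiation, which makes the derivatives in the two variables commute.
-/

namespace SmoothK

open CategoryTheory Topology Filter
open scoped unitInterval

set_option linter.unusedSectionVars false

noncomputable section

/-! ### Derivatives of families of maps -/

section Derivatives

variable {𝕜 : Type} [RCLike 𝕜] {A : Type u} [NonUnitalRing A] [Module 𝕜 A]

theorem HasDerivI.comp_continuousLinearMap {B : Type*} [NonUnitalRing B] [Module 𝕜 B]
    [TopologicalSpace A] [TopologicalSpace B] (L : A →L[𝕜] B) {f : I → A} {a : A} {t : I}
    (hf : HasDerivI 𝕜 f a t) : HasDerivI 𝕜 (L ∘ f) (L a) t := by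
  refine ((L.continuous.tendsto a).comp hf).congr fun s => ?_
  simp [map_smul, map_sub]

theorem HasDerivI.sub [TopologicalSpace A] [IsTopologicalAddGroup A] {f g : I → A} {a b : A}
    {t : I} (hf : HasDerivI 𝕜 f a t) (hg : HasDerivI 𝕜 g b t) :
    HasDerivI 𝕜 (f - g) (a - b) t := by
  refine (Tendsto.sub hf hg).congr fun s => ?_
  rw [← smul_sub, Pi.sub_apply, Pi.sub_apply]
  congr 1
  abel

/-- The derivative of `t ↦ t • g t`. -/
theorem HasDerivI.coord_smul [TopologicalSpace A] [IsTopologicalAddGroup A]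
    [ContinuousSMul 𝕜 A] {g : I → A} {b : A} {t : I} (hg : HasDerivI 𝕜 g b t) :
    HasDerivI 𝕜 (fun t : I => ((t : ℝ) : 𝕜) • g t) (g t + ((t : ℝ) : 𝕜) • b) t := by
  have hc : Tendsto g (𝓝[≠] t) (𝓝 (g t)) := hg.continuousAt.mono_left nhdsWithin_le_nhds
  refine (hc.add (Tendsto.const_smul hg ((t : ℝ) : 𝕜))).congr' ?_
  filter_upwards [self_mem_nhdsWithin] with s hs
  have hne : (((s : ℝ) - (t : ℝ) : ℝ) : 𝕜) ≠ 0 := by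
    rw [Ne, RCLike.ofReal_eq_zero, sub_eq_zero]
    exact fun h => hs (Subtype.ext h)
  have e : ((s : ℝ) : 𝕜) • g s - ((t : ℝ) : 𝕜) • g t
      = (((s : ℝ) - (t : ℝ) : ℝ) : 𝕜) • g s + ((t : ℝ) : 𝕜) • (g s - g t) := by
    rw [RCLike.ofReal_sub, sub_smul, smul_sub]
    abel
  rw [e, smul_add, smul_smul _ _ (g s), inv_mul_cancel₀ hne, one_smul, smul_comm]

/-- The chain rule for `t ↦ g (s * t)`. -/
theorem HasDerivI.comp_mul_left [TopologicalSpace A] [IsTopologicalAddGroup A]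
    [ContinuousSMul 𝕜 A] {g : I → A} {b : A} {s t : I} (hg : HasDerivI 𝕜 g b (s * t)) :
    HasDerivI 𝕜 (fun t => g (s * t)) (((s : ℝ) : 𝕜) • b) t := by
  -- For `s = 0` the map `x ↦ s * x` does not send `x ≠ t` to points different from `s * t`.
  rcases eq_or_ne s 0 with rfl | hs
  · simpa using hasDerivI_const (𝕜 := 𝕜) (g 0) t
  have hs' : (s : ℝ) ≠ 0 := fun h => hs (Subtype.ext h)
  have h1 : Tendsto (fun x : I => s * x) (𝓝[≠] t) (𝓝[≠] (s * t)) := by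
    refine tendsto_nhdsWithin_iff.2 ⟨?_, ?_⟩
    · exact ((continuous_const.mul continuous_id).tendsto t).mono_left nhdsWithin_le_nhds
    · filter_upwards [self_mem_nhdsWithin] with x hx h
      exact hx (Subtype.ext (mul_left_cancel₀ hs' (congrArg Subtype.val h)))
  refine (Tendsto.const_smul (hg.comp h1) ((s : ℝ) : 𝕜)).congr fun x => ?_
  have hs'' : ((s : ℝ) : 𝕜) ≠ 0 := by rwa [Ne, RCLike.ofReal_eq_zero]
  rw [Function.comp_apply, smul_smul]
  congr 1
  rw [Set.Icc.coe_mul, Set.Icc.coe_mul, ← mul_sub, RCLike.ofReal_mul, mul_inv,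
    mul_inv_cancel_left₀ hs'']

theorem seminorm_sub_le_of_le_uIcc [TopologicalSpace A] [IsTopologicalAddGroup A]
    [ContinuousSMul 𝕜 A] (p : Seminorm 𝕜 A) (hp : Continuous p) {f g : I → A}
    (hfg : ∀ t, HasDerivI 𝕜 f (g t) t) (c : A) (C : ℝ) {a b : I}
    (hC : ∀ x ∈ Set.uIcc a b, p (g x - c) ≤ C) :
    p (f b - f a - (((b : ℝ) - a : ℝ) : 𝕜) • c) ≤ C * |(b : ℝ) - a| := by
  rcases le_total a b with hab | hab
  · rw [abs_of_nonneg (sub_nonneg.2 (show (a : ℝ) ≤ b from hab))]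
    exact seminorm_sub_le_of_le p hp hfg c C hab fun x h1 h2 =>
      hC x (Set.mem_uIcc.2 (Or.inl ⟨h1, h2⟩))
  · have e : f b - f a - (((b : ℝ) - a : ℝ) : 𝕜) • c
        = -(f a - f b - (((a : ℝ) - b : ℝ) : 𝕜) • c) := by
      rw [← neg_sub (a : ℝ) b, RCLike.ofReal_neg, neg_smul]; abel
    rw [e, map_neg_eq_map, abs_sub_comm, abs_of_nonneg (sub_nonneg.2 (show (b : ℝ) ≤ a from hab))]
    exact seminorm_sub_le_of_le p hp hfg c C hab fun x h1 h2 =>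
      hC x (Set.mem_uIcc.2 (Or.inr ⟨h1, h2⟩))

variable [UniformSpace A] [IsUniformAddGroup A] [IsTopologicalRing A] [ContinuousSMul 𝕜 A]
  [PolynormableSpace 𝕜 A]

/-- A family of continuous maps on a compact space with pointwise derivative `Z s x` in the
parameter `s` is differentiable for the topology of uniform convergence as soon as `Z` is
continuous for that topology: by the mean value inequality the difference quotients converge
uniformly. -/
theorem hasDerivI_of_pointwise {X : Type*} [TopologicalSpace X] [CompactSpace X]
    {W Z : I → C(X, A)} (hZ : Continuous Z)
    (h : ∀ s x, HasDerivI 𝕜 (fun s => W s x) (Z s x) s) (s : I) : HasDerivI 𝕜 W (Z s) s := by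
  have hw := PolynormableSpace.withSeminorms 𝕜 A
  rw [HasDerivI, ContinuousMap.tendsto_iff_tendstoUniformly]
  intro U hU
  rw [uniformity_eq_comap_nhds_zero, mem_comap] at hU
  obtain ⟨V, hV, hVU⟩ := hU
  obtain ⟨⟨F, r⟩, hr, hF⟩ := hw.hasBasis_zero_ball.mem_iff.1 hV
  let p : Seminorm 𝕜 A := F.sup fun q => q.1
  have hp : Continuous p := Seminorm.continuous_finsetSup fun q _ => q.2
  have hosc : ∀ᶠ s' in 𝓝 s, ‖((ContinuousMap.mk p hp).comp (Z s' - Z s) : C(X, ℝ))‖ < r / 2 := by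
    have hc : Continuous fun s' => ‖((ContinuousMap.mk p hp).comp (Z s' - Z s) : C(X, ℝ))‖ :=
      continuous_norm.comp ((ContinuousMap.continuous_postcomp _).comp (hZ.sub continuous_const))
    refine (hc.tendsto s).eventually (gt_mem_nhds ?_)
    have e : (ContinuousMap.mk p hp).comp (Z s - Z s) = 0 := by
      ext x
      simp
    rw [e, norm_zero]
    exact half_pos hr
  obtain ⟨δ, hδ, hball⟩ := Metric.eventually_nhds_iff.1 hosc
  filter_upwards [self_mem_nhdsWithin, nhdsWithin_le_nhds (Metric.ball_mem_nhds s hδ)]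
    with s' hne hs' x
  apply hVU
  apply hF
  rw [Seminorm.mem_ball_zero]
  change p ((((s' : ℝ) - (s : ℝ) : ℝ) : 𝕜)⁻¹ • (W s' x - W s x) - Z s x) < r
  have hne0 : (s' : ℝ) - s ≠ 0 := by
    rw [Ne, sub_eq_zero]; exact fun h => hne (Subtype.ext h)
  have hne' : (((s' : ℝ) - s : ℝ) : 𝕜) ≠ 0 := by
    rw [Ne, RCLike.ofReal_eq_zero]; exact hne0
  have hmv := seminorm_sub_le_of_le_uIcc p hp (fun t => h t x) (Z s x) (r / 2) (a := s) (b := s')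
    (fun y hy => by
      have hy' : dist y s < δ := by
        refine lt_of_le_of_lt ?_ hs'
        rw [Subtype.dist_eq, Subtype.dist_eq, Real.dist_eq, Real.dist_eq]
        refine Set.abs_sub_left_of_mem_uIcc (a := (s : ℝ)) (b := s') ?_
        rw [Set.mem_uIcc] at hy ⊢
        exact hy
      refine le_trans ?_ (hball hy').le
      exact (le_abs_self _).trans (ContinuousMap.norm_coe_le_norm
        ((ContinuousMap.mk p hp).comp (Z y - Z s) : C(X, ℝ)) x))
  have e : (((s' : ℝ) - (s : ℝ) : ℝ) : 𝕜)⁻¹ • (W s' x - W s x) - Z s x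
      = (((s' : ℝ) - (s : ℝ) : ℝ) : 𝕜)⁻¹ •
        (W s' x - W s x - (((s' : ℝ) - s : ℝ) : 𝕜) • Z s x) := by
    rw [smul_sub _ (W s' x - W s x), smul_smul, inv_mul_cancel₀ hne', one_smul]
  rw [e, map_smul_eq_mul, norm_inv, RCLike.norm_ofReal]
  have hpos := abs_pos.2 hne0
  refine lt_of_le_of_lt ?_ (half_lt_self hr)
  rw [inv_mul_le_iff₀ hpos, mul_comm]
  exact hmv

end Derivatives

namespace SmoothMap

section

variable {𝕜 : Type} [RCLike 𝕜] {A : Type u} [NonUnitalRing A] [Module 𝕜 A]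
  [IsScalarTower 𝕜 A A] [SMulCommClass 𝕜 A A] [UniformSpace A] [IsUniformAddGroup A]
  [ContinuousSMul 𝕜 A] [ContinuousMul A] [T2Space A]

theorem continuous_jet_eval (k : ℕ) :
    Continuous fun q : SmoothMap 𝕜 A × I => jet q.1 k q.2 :=
  ContinuousEval.continuous_eval.comp
    (((continuous_jet_apply k).comp continuous_fst).prodMk continuous_snd)

theorem continuous_apply_eval : Continuous fun q : SmoothMap 𝕜 A × I => q.1 q.2 :=
  continuous_jet_eval 0

/-- Continuity of a family of smooth maps can be tested on the joint continuity of all the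
derivatives. -/
theorem continuous_of_continuous_jet {X : Type*} [TopologicalSpace X] {u : X → SmoothMap 𝕜 A}
    (h : ∀ k, Continuous fun q : X × I => jet (u q.1) k q.2) : Continuous u := by
  rw [isInducing_jet.continuous_iff]
  exact continuous_pi fun k => ContinuousMap.continuous_of_continuous_uncurry _ (h k)

variable [PolynormableSpace 𝕜 A]

/-- For a family `w` of smooth maps with values in `A`, the derivatives in the parameter and in the
variable commute: the derivative in the variable is the limit of the difference quotients, uniformly
in the parameter, and differentiation is a closed operator. -/
theorem hasDerivI_deriv_of_pointwise {w z : I → SmoothMap 𝕜 A} (hw : Continuous w)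
    (hz : Continuous z) (h : ∀ s t, HasDerivI 𝕜 (fun s => w s t) (z s t) s) (s t : I) :
    HasDerivI 𝕜 (fun s => deriv (w s) t) (deriv (z s) t) s := by
  have : IsTopologicalRing A := {}
  -- `S v hv t` is the map `s ↦ v s t`.
  let S : (v : I → SmoothMap 𝕜 A) → Continuous v → I → C(I, A) := fun v hv t =>
    ⟨fun s => v s t, continuous_apply_eval.comp (hv.prodMk _root_.continuous_const)⟩
  have hS : ∀ (v : I → SmoothMap 𝕜 A) (hv : Continuous v), Continuous (S v hv) := fun v hv =>
    ContinuousMap.continuous_of_continuous_uncurry _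
      (continuous_apply_eval.comp ((hv.comp continuous_snd).prodMk continuous_fst))
  have hd : ∀ (v : I → SmoothMap 𝕜 A) (hv : Continuous v),
      HasDerivI 𝕜 (S v hv) (S _ (continuous_deriv.comp hv) t) t := fun v hv =>
    hasDerivI_of_pointwise (hS _ (continuous_deriv.comp hv))
      (fun t s => hasDerivI_deriv (v s) t) t
  have hlim := (hd w hw).prodMk_nhds (hd z hz)
  exact isClosed_hasDerivI.mem_of_tendsto hlim (Eventually.of_forall fun t' s =>
    ((h s t').sub (h s t)).smul _) s

theorem hasDerivI_jet_of_pointwise {w z : I → SmoothMap 𝕜 A} (hw : Continuous w)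
    (hz : Continuous z) (h : ∀ s t, HasDerivI 𝕜 (fun s => w s t) (z s t) s) (k : ℕ) (s t : I) :
    HasDerivI 𝕜 (fun s => jet (w s) k t) (jet (z s) k t) s := by
  induction k generalizing w z with
  | zero => exact h s t
  | succ k ih =>
    simp only [← jet_deriv]
    exact ih (continuous_deriv.comp hw) (continuous_deriv.comp hz)
      (hasDerivI_deriv_of_pointwise hw hz h)

/-- A continuous family `w` of smooth maps whose pointwise derivative in the parameter is given by
a continuous family `z` of smooth maps has derivative `z` in the topology of `A^{∞(I)}`. -/
theorem hasDerivI_of_pointwise {w z : I → SmoothMap 𝕜 A} (hw : Continuous w)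
    (hz : Continuous z) (h : ∀ s t, HasDerivI 𝕜 (fun s => w s t) (z s t) s) (s : I) :
    HasDerivI 𝕜 w (z s) s := by
  rw [HasDerivI, isInducing_jet.tendsto_nhds_iff, tendsto_pi_nhds]
  have : IsTopologicalRing A := {}
  intro k
  refine (SmoothK.hasDerivI_of_pointwise ((continuous_jet_apply k).comp hz)
    (hasDerivI_jet_of_pointwise hw hz h k) s).congr fun s' => ?_
  rw [Function.comp_apply, map_smul, map_sub]
  rfl

end

/-! ### Composition with continuous linear maps -/

section Postcomp

variable {𝕜 : Type} [RCLike 𝕜] {A B : Type u}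
  [NonUnitalRing A] [Module 𝕜 A] [IsScalarTower 𝕜 A A] [SMulCommClass 𝕜 A A]
  [UniformSpace A] [IsUniformAddGroup A] [ContinuousSMul 𝕜 A] [ContinuousMul A] [T2Space A]
  [NonUnitalRing B] [Module 𝕜 B] [IsScalarTower 𝕜 B B] [SMulCommClass 𝕜 B B]
  [UniformSpace B] [IsUniformAddGroup B] [ContinuousSMul 𝕜 B] [ContinuousMul B] [T2Space B]

theorem isSmooth_postcomp (L : A →L[𝕜] B) (f : SmoothMap 𝕜 A) : IsSmooth 𝕜 (L ∘ f) :=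
  ⟨fun k => L ∘ jet f k, rfl, fun k t => (hasDerivI_jet f k t).comp_continuousLinearMap L⟩

/-- The smooth map `L ∘ f`, for a continuous linear map `L`. -/
def postcomp (L : A →L[𝕜] B) (f : SmoothMap 𝕜 A) : SmoothMap 𝕜 B :=
  ⟨L ∘ f, isSmooth_postcomp L f⟩

@[simp] theorem postcomp_apply (L : A →L[𝕜] B) (f : SmoothMap 𝕜 A) (t : I) :
    postcomp L f t = L (f t) := rfl

theorem jet_postcomp (L : A →L[𝕜] B) (f : SmoothMap 𝕜 A) (k : ℕ) (t : I) :
    jet (postcomp L f) k t = L (jet f k t) := by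
  induction k generalizing f with
  | zero => rfl
  | succ k ih =>
    have h : deriv (postcomp L f) = postcomp L (deriv f) :=
      deriv_eq fun t => (hasDerivI_deriv f t).comp_continuousLinearMap L
    rw [← jet_deriv, h, ih, jet_deriv]

theorem jet_map (φ : A →ₙₐ[𝕜] B) (hφ : Continuous φ) (f : SmoothMap 𝕜 A) (k : ℕ) (t : I) :
    jet (map φ hφ f) k t = φ (jet f k t) :=
  jet_postcomp ⟨(φ : A →ₗ[𝕜] B), hφ⟩ f k t

theorem continuous_postcomp (L : A →L[𝕜] B) : Continuous (postcomp L) :=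
  continuous_of_continuous_jet fun k => by
    simp only [jet_postcomp]
    exact L.continuous.comp (continuous_jet_eval k)

/-- Composition with a homomorphism that induces the topology again induces the topology. -/
theorem isInducing_map (φ : A →ₙₐ[𝕜] B) (hφ : IsInducing φ) :
    IsInducing (map φ hφ.continuous) := by
  have h : (jet ∘ map φ hφ.continuous : SmoothMap 𝕜 A → ℕ → C(I, B))
      = Pi.map (fun _ => (ContinuousMap.mk φ hφ.continuous).comp) ∘ jet := by
    funext f k
    ext t
    exact jet_map φ hφ.continuous f k t
  rw [← isInducing_jet.of_comp_iff, h]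
  exact (IsInducing.piMap fun _ => ContinuousMap.isInducing_postcomp _ hφ).comp isInducing_jet

end Postcomp

variable {𝕜 : Type} [RCLike 𝕜] {A : Type u} [NonUnitalRing A] [Module 𝕜 A]
  [IsScalarTower 𝕜 A A] [SMulCommClass 𝕜 A A] [UniformSpace A] [IsUniformAddGroup A]
  [ContinuousSMul 𝕜 A] [ContinuousMul A] [T2Space A]

variable (𝕜 A) in
/-- Differentiation as a continuous linear map. -/
def derivCLM : SmoothMap 𝕜 A →L[𝕜] SmoothMap 𝕜 A := ⟨deriv, continuous_deriv⟩

/-! ### Exchanging the variables of a smooth map of two variables -/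

theorem continuous_map_eval :
    Continuous fun q : SmoothMap 𝕜 (SmoothMap 𝕜 A) × I => map (eval q.2) (continuous_eval q.2) q.1 :=
  continuous_of_continuous_jet fun k => by
    simp only [jet_map]
    exact continuous_apply_eval.comp (((continuous_jet_eval k).comp
      ((continuous_fst.comp continuous_fst).prodMk continuous_snd)).prodMk
        (continuous_snd.comp continuous_fst))

variable [PolynormableSpace 𝕜 A]

theorem hasDerivI_map_eval (f : SmoothMap 𝕜 (SmoothMap 𝕜 A)) (t : I) :
    HasDerivI 𝕜 (fun t => map (eval t) (continuous_eval t) f)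
      (map (eval t) (continuous_eval t) (postcomp (derivCLM 𝕜 A) f)) t :=
  hasDerivI_of_pointwise (w := fun t => map (eval t) (continuous_eval t) f)
    (z := fun t => map (eval t) (continuous_eval t) (postcomp (derivCLM 𝕜 A) f))
    (continuous_map_eval.comp (_root_.continuous_const.prodMk continuous_id))
    (continuous_map_eval.comp (_root_.continuous_const.prodMk continuous_id))
    (fun t s => hasDerivI_deriv (f s) t) t

/-- The exchange `(swap f) t s = f s t` of the variables of a smooth map of two variables. -/
def swap : SmoothMap 𝕜 (SmoothMap 𝕜 A) →ₙₐ[𝕜] SmoothMap 𝕜 (SmoothMap 𝕜 A) where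
  toFun f := ⟨fun t => map (eval t) (continuous_eval t) f,
    isSmooth_of_closed (Set.range fun f t => map (eval t) (continuous_eval t) f)
      (by rintro _ ⟨f, rfl⟩; exact ⟨_, ⟨_, rfl⟩, hasDerivI_map_eval f⟩) ⟨f, rfl⟩⟩
  map_smul' _ _ := rfl
  map_zero' := rfl
  map_add' _ _ := rfl
  map_mul' _ _ := rfl

theorem deriv_swap (f : SmoothMap 𝕜 (SmoothMap 𝕜 A)) :
    deriv (swap f) = swap (postcomp (derivCLM 𝕜 A) f) :=
  deriv_eq (hasDerivI_map_eval f)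

theorem continuous_swap :
    Continuous (swap : SmoothMap 𝕜 (SmoothMap 𝕜 A) → SmoothMap 𝕜 (SmoothMap 𝕜 A)) :=
  continuous_of_continuous_jet fun k => by
    induction k with
    | zero => exact continuous_map_eval
    | succ k ih =>
      simp only [← jet_deriv, deriv_swap]
      exact ih.comp ((continuous_postcomp _).prodMap continuous_id)

theorem swap_mem_paths {f : SmoothMap 𝕜 (SmoothMap 𝕜 A)} (hf : f 0 = 0) (t : I) :
    swap f t ∈ paths 𝕜 A := by
  change f 0 t = 0
  rw [hf]
  rfl

theorem isSmooth_pathSwap (f : SmoothMap 𝕜 (SmoothMap 𝕜 A)) (hf : f 0 = 0) :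
    IsSmooth 𝕜 (fun t => (⟨swap f t, swap_mem_paths hf t⟩ : paths 𝕜 A)) := by
  refine isSmooth_of_closed {u | ∃ (f : SmoothMap 𝕜 (SmoothMap 𝕜 A)) (hf : f 0 = 0),
    u = fun t => (⟨swap f t, swap_mem_paths hf t⟩ : paths 𝕜 A)} ?_ ⟨f, hf, rfl⟩
  rintro _ ⟨f, hf, rfl⟩
  refine ⟨_, ⟨postcomp (derivCLM 𝕜 A) f, ?_, rfl⟩, fun t => ?_⟩
  · rw [postcomp_apply, hf, map_zero]
  · rw [HasDerivI, IsInducing.subtypeVal.tendsto_nhds_iff]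
    exact hasDerivI_map_eval f t

/-- The homomorphism `𝓘(A^{∞(I)}) → 𝓘(A)^{∞(I)}` exchanging the variables. -/
def pathSwap : paths 𝕜 (SmoothMap 𝕜 A) →ₙₐ[𝕜] SmoothMap 𝕜 (paths 𝕜 A) where
  toFun f := ⟨_, isSmooth_pathSwap f.1 f.2⟩
  map_smul' _ _ := rfl
  map_zero' := rfl
  map_add' _ _ := rfl
  map_mul' _ _ := rfl

theorem continuous_pathSwap : Continuous (pathSwap (𝕜 := 𝕜) (A := A)) :=
  (isInducing_map (NonUnitalSubalgebraClass.subtype (paths 𝕜 A))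
    IsInducing.subtypeVal).continuous_iff.2 (continuous_swap.comp continuous_subtype_val)

/-! ### The contraction of the interval -/

theorem isSmooth_rescale (s : I) (f : SmoothMap 𝕜 A) : IsSmooth 𝕜 (fun t => f (s * t)) := by
  refine ⟨fun k t => ((s : ℝ) : 𝕜) ^ k • jet f k (s * t), ?_, fun k t => ?_⟩
  · simp [jet_zero]
  · beta_reduce
    rw [pow_succ, mul_smul]
    exact (hasDerivI_jet f k (s * t)).comp_mul_left.smul _

/-- The smooth map `t ↦ f (s * t)`. -/
def rescale (s : I) (f : SmoothMap 𝕜 A) : SmoothMap 𝕜 A := ⟨_, isSmooth_rescale s f⟩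

theorem rescale_apply (s t : I) (f : SmoothMap 𝕜 A) : rescale s f t = f (s * t) := rfl

theorem deriv_rescale (s : I) (f : SmoothMap 𝕜 A) :
    deriv (rescale s f) = ((s : ℝ) : 𝕜) • rescale s (deriv f) :=
  deriv_eq fun t => (hasDerivI_deriv f (s * t)).comp_mul_left

theorem jet_rescale (s t : I) (f : SmoothMap 𝕜 A) (k : ℕ) :
    jet (rescale s f) k t = ((s : ℝ) : 𝕜) ^ k • jet f k (s * t) := by
  induction k generalizing f with
  | zero => simp [jet_zero, rescale_apply]
  | succ k ih =>
    rw [← jet_deriv, deriv_rescale, map_smul, Pi.smul_apply, ContinuousMap.smul_apply, ih,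
      jet_deriv, smul_smul, pow_succ']

theorem continuous_rescale : Continuous fun q : SmoothMap 𝕜 A × I => rescale q.2 q.1 :=
  continuous_of_continuous_jet fun k => by
    simp only [jet_rescale]
    have h : Continuous fun q : (SmoothMap 𝕜 A × I) × I => (q.1.1, q.1.2 * q.2) :=
      (continuous_fst.comp continuous_fst).prodMk
        ((continuous_snd.comp continuous_fst).mul continuous_snd)
    exact Continuous.smul (by fun_prop) ((continuous_jet_eval k).comp h)

theorem hasDerivI_coordMul (f : SmoothMap 𝕜 A) (t : I) :
    HasDerivI 𝕜 (fun t : I => ((t : ℝ) : 𝕜) • f t) (f t + ((t : ℝ) : 𝕜) • deriv f t) t :=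
  (hasDerivI_deriv f t).coord_smul

/-- Multiplication by the coordinate function of `[0,1]`, as a linear map. -/
def coordMulₗ : SmoothMap 𝕜 A →ₗ[𝕜] SmoothMap 𝕜 A where
  toFun f := ⟨fun t => ((t : ℝ) : 𝕜) • f t,
    isSmooth_of_closed {u | ∃ f g : SmoothMap 𝕜 A, u = fun t : I => f t + ((t : ℝ) : 𝕜) • g t}
      (by
        rintro _ ⟨f, g, rfl⟩
        refine ⟨_, ⟨deriv f + g, deriv g, rfl⟩, fun t => ?_⟩
        rw [add_apply, add_assoc]
        exact (hasDerivI_deriv f t).add (hasDerivI_coordMul g t))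
      ⟨0, f, by simp⟩⟩
  map_add' f g := ext fun t => smul_add _ (f t) (g t)
  map_smul' c f := ext fun t => smul_comm _ c (f t)

theorem deriv_coordMulₗ (f : SmoothMap 𝕜 A) :
    deriv (coordMulₗ f) = f + coordMulₗ (deriv f) :=
  deriv_eq (hasDerivI_coordMul f)

theorem continuous_coordMulₗ : Continuous (coordMulₗ : SmoothMap 𝕜 A → SmoothMap 𝕜 A) :=
  continuous_of_continuous_jet fun k => by
    induction k with
    | zero =>
      change Continuous fun q : SmoothMap 𝕜 A × I => ((q.2 : ℝ) : 𝕜) • q.1 q.2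
      exact Continuous.smul (by fun_prop) continuous_apply_eval
    | succ k ih =>
      simp only [← jet_deriv, deriv_coordMulₗ, map_add, Pi.add_apply, ContinuousMap.add_apply]
      exact (continuous_jet_eval k).add (ih.comp (continuous_deriv.prodMap continuous_id))

variable (𝕜 A) in
/-- Multiplication by the coordinate function of `[0,1]`, as a continuous linear map. -/
def coordMul : SmoothMap 𝕜 A →L[𝕜] SmoothMap 𝕜 A := ⟨coordMulₗ, continuous_coordMulₗ⟩

theorem hasDerivI_rescale (f : SmoothMap 𝕜 A) (s : I) :
    HasDerivI 𝕜 (fun s => rescale s f) (coordMul 𝕜 A (rescale s (deriv f))) s := by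
  have h : ∀ g : SmoothMap 𝕜 A, Continuous fun s => rescale s g := fun g =>
    continuous_rescale.comp (_root_.continuous_const.prodMk continuous_id)
  refine hasDerivI_of_pointwise (w := fun s => rescale s f)
    (z := fun s => coordMul 𝕜 A (rescale s (deriv f))) (h f)
    ((coordMul 𝕜 A).continuous.comp (h _)) (fun s t => ?_) s
  have := (hasDerivI_deriv f (t * s)).comp_mul_left
  simp only [mul_comm t] at this
  exact this

/-- The map `s ↦ (t ↦ f (s * t))` is smooth: its derivatives are the maps
`s ↦ (t ↦ t ^ j • f⁽ʲ⁾ (s * t))`. -/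
theorem isSmooth_contract (f : SmoothMap 𝕜 A) : IsSmooth 𝕜 (fun s => rescale s f) := by
  refine isSmooth_of_closed
    {u | ∃ (j : ℕ) (g : SmoothMap 𝕜 A), u = fun s => (coordMul 𝕜 A ^ j) (rescale s g)} ?_
    ⟨0, f, rfl⟩
  rintro _ ⟨j, g, rfl⟩
  refine ⟨_, ⟨j + 1, deriv g, rfl⟩, fun t => ?_⟩
  rw [pow_succ]
  exact (hasDerivI_rescale g t).comp_continuousLinearMap (coordMul 𝕜 A ^ j)

/-- The homomorphism `A^{∞(I)} → (A^{∞(I)})^{∞(I)}`, `f ↦ (s ↦ (t ↦ f (s * t)))`. -/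
def contract : SmoothMap 𝕜 A →ₙₐ[𝕜] SmoothMap 𝕜 (SmoothMap 𝕜 A) where
  toFun f := ⟨fun s => rescale s f, isSmooth_contract f⟩
  map_smul' _ _ := rfl
  map_zero' := rfl
  map_add' _ _ := rfl
  map_mul' _ _ := rfl

theorem deriv_contract (f : SmoothMap 𝕜 A) :
    deriv (contract f) = postcomp (coordMul 𝕜 A) (contract (deriv f)) :=
  deriv_eq (hasDerivI_rescale f)

theorem continuous_contract : Continuous (contract (𝕜 := 𝕜) (A := A)) :=
  continuous_of_continuous_jet fun k => by
    induction k with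
    | zero => exact continuous_rescale
    | succ k ih =>
      simp only [← jet_deriv, deriv_contract, jet_postcomp]
      exact (coordMul 𝕜 A).continuous.comp (ih.comp (continuous_deriv.prodMap continuous_id))

end SmoothMap

section Homotopy

/-! ### Smooth homotopies and the path functors -/

variable {𝕜 : Type} [RCLike 𝕜]

/-- The exchange of variables as a morphism `𝓘(Z) → 𝓘(X)^{∞(I)}`, for a given morphism
`ψ : Z → X^{∞(I)}`. -/
def swapStep {Z X : LCAlg.{u} 𝕜} (ψ : Z ⟶ (smoothF 𝕜).obj X) :
    (pathF 𝕜).obj Z ⟶ (smoothF 𝕜).obj ((pathF 𝕜).obj X) :=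
  (pathF 𝕜).map ψ ≫ ⟨SmoothMap.pathSwap, SmoothMap.continuous_pathSwap⟩

theorem swapStep_ev (t : I) {Z X : LCAlg.{u} 𝕜} (ψ : Z ⟶ (smoothF 𝕜).obj X) :
    swapStep ψ ≫ (ev 𝕜 t).app ((pathF 𝕜).obj X) = (pathF 𝕜).map (ψ ≫ (ev 𝕜 t).app X) := rfl

theorem tau_swapStep {Z X : LCAlg.{u} 𝕜} (ψ : Z ⟶ (smoothF 𝕜).obj X) :
    (tau 𝕜).app Z ≫ ψ = swapStep ψ ≫ (smoothF 𝕜).map ((tau 𝕜).app X) := rfl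

/-- The exchange of variables is natural; `w` is the compatibility of `ψ` and `ψ'` with `d` and
`e`. -/
theorem map_swapStep {Z X Z' X' : LCAlg.{u} 𝕜} {ψ : Z ⟶ (smoothF 𝕜).obj X}
    {ψ' : Z' ⟶ (smoothF 𝕜).obj X'} {d : Z ⟶ Z'} {e : X ⟶ X'}
    (w : d ≫ ψ' = ψ ≫ (smoothF 𝕜).map e) :
    (pathF 𝕜).map d ≫ swapStep ψ' = swapStep ψ ≫ (smoothF 𝕜).map ((pathF 𝕜).map e) := by
  have h : (pathF 𝕜).map d ≫ swapStep ψ' = swapStep (d ≫ ψ') := rfl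
  rw [h, w]
  rfl

variable (𝕜) in
/-- The iterated exchange of variables `𝓘ⁿ(A^{∞(I)}) → 𝓘ⁿ(A)^{∞(I)}`. -/
def iterSwap : (n : ℕ) → (A : LCAlg.{u} 𝕜) →
    ((pathIter 𝕜 n).obj ((smoothF 𝕜).obj A) ⟶ (smoothF 𝕜).obj ((pathIter 𝕜 n).obj A))
  | 0, A => 𝟙 ((smoothF 𝕜).obj A)
  | n + 1, A => swapStep (iterSwap n A)

theorem iterSwap_ev (t : I) (n : ℕ) (A : LCAlg.{u} 𝕜) :
    iterSwap 𝕜 n A ≫ (ev 𝕜 t).app ((pathIter 𝕜 n).obj A)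
      = (pathIter 𝕜 n).map ((ev 𝕜 t).app A) := by
  induction n with
  | zero => exact Category.id_comp ((ev 𝕜 t).app A)
  | succ n ih => exact (swapStep_ev t (iterSwap 𝕜 n A)).trans (congrArg (pathF 𝕜).map ih)

theorem iterSwap_face : ∀ (n : ℕ) (i : Fin (n + 1)) (A : LCAlg.{u} 𝕜),
    (face 𝕜 n i).app ((smoothF 𝕜).obj A) ≫ iterSwap 𝕜 n A
      = iterSwap 𝕜 (n + 1) A ≫ (smoothF 𝕜).map ((face 𝕜 n i).app A)
  | 0, ⟨0, _⟩, A => tau_swapStep (iterSwap 𝕜 0 A)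
  | n + 1, ⟨0, _⟩, A => tau_swapStep (iterSwap 𝕜 (n + 1) A)
  | n + 1, ⟨i + 1, h⟩, A => map_swapStep (iterSwap_face n ⟨i, Nat.lt_of_succ_lt_succ h⟩ A)

theorem smoothHomotopic_ev_incl (A : LCAlg.{u} 𝕜) :
    SmoothHomotopic ((ev 𝕜 0).app A ≫ (incl 𝕜).app A) (𝟙 ((smoothF 𝕜).obj A)) := by
  refine ⟨⟨SmoothMap.contract, SmoothMap.continuous_contract⟩, ?_, ?_⟩
  · refine LCAlg.hom_ext fun f => SmoothMap.ext fun t => ?_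
    exact congrArg f.1 (zero_mul t)
  · refine LCAlg.hom_ext fun f => SmoothMap.ext fun t => ?_
    exact congrArg f.1 (one_mul t)

/-! ### Homotopy invariance -/

/-- Dividing an element of `GL(X^{∞(I)})` by its value at `0` gives an element of `GL(𝓘(X))`. -/
theorem exists_path_div {X : LCAlg.{u} 𝕜} (x : (glF 𝕜).obj ((smoothF 𝕜).obj X)) :
    ∃ y : (glF 𝕜).obj ((pathF 𝕜).obj X),
      glTau X y = ((glF 𝕜).map ((ev 𝕜 1).app X)).hom x *
        (((glF 𝕜).map ((ev 𝕜 0).app X)).hom x)⁻¹ ∧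
      ∀ (Y : LCAlg.{u} 𝕜) (φ : X ⟶ Y), ((glF 𝕜).map ((smoothF 𝕜).map φ)).hom x = 1 →
        ((glF 𝕜).map ((pathF 𝕜).map φ)).hom y = 1 := by
  set g : (glF 𝕜).obj X := ((glF 𝕜).map ((ev 𝕜 0).app X)).hom x
  let c : (glF 𝕜).obj ((smoothF 𝕜).obj X) := ((glF 𝕜).map ((incl 𝕜).app X)).hom g
  have hc : ∀ t, ((glF 𝕜).map ((ev 𝕜 t).app X)).hom c = g := fun t => by
    have : (incl 𝕜).app X ≫ (ev 𝕜 t).app X = 𝟙 X ≫ 𝟙 X := rfl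
    rw [glF_comp_apply this]
    simp
  obtain ⟨y, hy⟩ : ∃ y, ((glF 𝕜).map ((pathIncl 𝕜).app X)).hom y = x * c⁻¹ :=
    GenLin.exists_of_map_eq_one ((pathIncl 𝕜).app X).hom
      ((ev 𝕜 0).app X).hom Subtype.val_injective (fun b hb => ⟨⟨b, hb⟩, rfl⟩) (x * c⁻¹) (by
        change ((glF 𝕜).map ((ev 𝕜 0).app X)).hom (x * c⁻¹) = 1
        rw [map_mul, map_inv, hc, mul_inv_cancel])
  refine ⟨y, ?_, fun Y φ hx => ?_⟩
  · have : glTau X y = ((glF 𝕜).map ((ev 𝕜 1).app X)).hom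
        (((glF 𝕜).map ((pathIncl 𝕜).app X)).hom y) := (GenLin.map_map _ _ y).symm
    rw [this, hy, map_mul, map_inv, hc]
  · have hg1 : ((glF 𝕜).map φ).hom g = 1 := by
      exact (glF_comp_apply ((ev 𝕜 0).naturality φ) x).symm.trans
        ((congrArg _ hx).trans (map_one _))
    have hc1 : ((glF 𝕜).map ((smoothF 𝕜).map φ)).hom c = 1 := by
      rw [← glF_comp_apply ((incl 𝕜).naturality φ)]
      exact (congrArg _ hg1).trans (map_one _)
    have hinj : Function.Injective ((glF 𝕜).map ((pathIncl 𝕜).app Y)).hom :=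
      GenLin.map_injective ((pathIncl 𝕜).app Y).hom Subtype.val_injective
    apply hinj
    rw [glF_comp_apply ((pathIncl 𝕜).naturality φ), hy, map_mul, map_inv, hx, hc1, inv_one,
      mul_one, map_one]

/-- On cycles, smooth homotopic morphisms differ by boundaries. -/
theorem glMap_mul_inv_mem_boundaries (n : ℕ) {A B : LCAlg.{u} 𝕜} (h : A ⟶ (smoothF 𝕜).obj B)
    {x : glPath n A} (hx : x ∈ cycles n A) :
    glMap n (h ≫ (ev 𝕜 1).app B) x * (glMap n (h ≫ (ev 𝕜 0).app B) x)⁻¹ ∈ boundaries n B := by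
  let x' : (glF 𝕜).obj ((smoothF 𝕜).obj ((pathIter 𝕜 n).obj B)) :=
    ((glF 𝕜).map (iterSwap 𝕜 n B)).hom (glMap n h x)
  have hev : ∀ t, ((glF 𝕜).map ((ev 𝕜 t).app ((pathIter 𝕜 n).obj B))).hom x'
      = glMap n (h ≫ (ev 𝕜 t).app B) x := fun t => by
    have e : ((pathIter 𝕜 n).map h ≫ iterSwap 𝕜 n B) ≫ (ev 𝕜 t).app ((pathIter 𝕜 n).obj B)
        = (pathIter 𝕜 n).map (h ≫ (ev 𝕜 t).app B) := by
      rw [Category.assoc, iterSwap_ev, ← CategoryTheory.Functor.map_comp]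
    have e' := congrArg (fun g => ((glF 𝕜).map g).hom x) e
    simp only [CategoryTheory.Functor.map_comp (glF 𝕜)] at e'
    exact e'
  obtain ⟨y, hy1, hy2⟩ := exists_path_div x'
  rw [hev, hev] at hy1
  refine ⟨y, mem_moore.2 ?_, ?_⟩
  · cases n with
    | zero => exact fun i => i.elim0
    | succ n =>
      intro i
      refine hy2 _ ((face 𝕜 n i).app B) ?_
      simp only [cycles, Subgroup.mem_iInf, MonoidHom.mem_ker] at hx
      change ((glF 𝕜).map ((smoothF 𝕜).map ((face 𝕜 n i).app B))).hom
        (((glF 𝕜).map (iterSwap 𝕜 (n + 1) B)).hom (glMap (n + 1) h x)) = 1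
      rw [← glF_comp_apply (iterSwap_face n i B)]
      change ((glF 𝕜).map (iterSwap 𝕜 n B)).hom (glFace n i _ (glMap (n + 1) h x)) = 1
      rw [glFace_natural, hx i, map_one, map_one]
  · rw [glFace, face_zero_app]
    exact hy1

theorem isSmoothHomotopyFunctor_homotopyF (n : ℕ) :
    IsSmoothHomotopyFunctor (homotopyF.{u} 𝕜 n) := by
  rintro A B _ _ ⟨h, rfl, rfl⟩
  refine GrpCat.hom_ext (MonoidHom.ext fun x => ?_)
  induction x using QuotientGroup.induction_on with
  | H x =>
    refine QuotientGroup.eq.2 ?_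
    -- The boundaries are normal, so both orders of the quotient are boundaries.
    change (glMap n (h ≫ (ev 𝕜 0).app B) x.1)⁻¹ * glMap n (h ≫ (ev 𝕜 1).app B) x.1
      ∈ boundaries n B
    exact (boundaries_normal n B).mem_comm (glMap_mul_inv_mem_boundaries n h x.2)

/-- A smooth homotopy functor inverts the inclusions `A → A^{∞(I)}` of the constant maps. -/
theorem IsSmoothHomotopyFunctor.isIso_map_incl {T : LCAlg.{u} 𝕜 ⥤ GrpCat.{u}}
    (hT : IsSmoothHomotopyFunctor T) (A : LCAlg.{u} 𝕜) : IsIso (T.map ((incl 𝕜).app A)) := by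
  refine ⟨T.map ((ev 𝕜 0).app A), ?_, ?_⟩
  · rw [← T.map_comp]
    exact T.map_id A
  · rw [← T.map_comp, hT _ _ (smoothHomotopic_ev_incl A)]
    exact T.map_id _

end Homotopy

end

end SmoothK

theorem proposition1p8 (𝕜 : Type) [RCLike 𝕜] (n : ℕ+) :
    SmoothK.IsSmoothHomotopyFunctor (SmoothK.Ksm.{u} 𝕜 n) ∧
      ∀ A : SmoothK.LCAlg.{u} 𝕜,
        CategoryTheory.IsIso ((SmoothK.Ksm 𝕜 n).map ((SmoothK.incl 𝕜).app A)) :=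
  have h := SmoothK.isSmoothHomotopyFunctor_homotopyF n.natPred
  ⟨h, h.isIso_map_incl⟩
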